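/- Let $n\in\mathbb N$, $b>0$, $T>0$, $A\in\mathbb R^{n\times n}$, $g\in L^2(0,T;\mathbb R^n)$ and $\varphi\in H^1(-b,0;\mathbb R^n)$. Let $f:\mathbb R^n\to\mathbb R^n$ be continuously differentiable, and assume that there is $\lambda>0$ such that $Df(x)+\lambda I$ is positive semi-definite for all $x\in\mathbb R^n$, i.e. $\langle (Df(x)+\lambda I)v,v\rangle\ge 0$ for all $x,v\in\mathbb R^n$. Then for each $\tau\in[0,b]$ the delay equation $$\dot x(t)+f(x(t))=A\,x(t-\tau)+g(t)\ \text{ for a.e. } t\in(0,T),\qquad x(t)=\varphi(t)\ \text{ for } t\in[-b,0],$$ has a unique solution $x=x[\tau]\in H^1(-b,T;\mathbb R^n)$, and the following holds. (i) The mapping $\tau\mapsto x[\tau]$ is continuously differentiable from $[0,b]$ to $H^1(-b,T;\mathbb R^n)$ (with one-sided derivatives at $\tau=0$ and $\tau=b$). (ii) For each $\tau\in[0,b]$ the derivative $w=x'[\tau]=\partial_\tau x[\tau]$ is the unique solution in $H^1(-b,T;\mathbb R^n)$ of the linear delay equation $$\dot w(t)+Df(x[\tau](t))\,w(t)=A\,w(t-\tau)-A\,\dot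 x[\tau](t-\tau)\ \text{ for a.e. } t\in(0,T),\qquad w(t)=0\ \text{ for } t\in[-b,0].$$ (iii) For each $\tau\in[0,b]$, the mapping $\sigma\mapsto\partial_t x[\sigma]|_{(0,T)}$ from $[0,b]$ to $L^2(0,T;\mathbb R^n)$ is differentiable at $\tau$, and $$\partial_\tau\partial_t x[\tau]=\partial_t\partial_\tau x[\tau]\quad\text{in } L^2(0,T;\mathbb R^n).$$ -/

import Mathlib

namespace DelayEq

open MeasureTheory Set
open scoped ContDiff

/-- The Euclidean space `ℝⁿ`. -/
abbrev Vec (n : ℕ) : Type := EuclideanSpace ℝ (Fin n)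

/-- The Lebesgue space `L²(a,b;ℝⁿ)`. -/
abbrev L2 (n : ℕ) (a b : ℝ) : Type :=
  Lp (Vec n) 2 ((volume : Measure ℝ).restrict (Ioo a b))

/-- The scalar test functions on `(a,b)`: smooth, with compact support inside `(a,b)`. -/
def IsTest (a b : ℝ) (η : ℝ → ℝ) : Prop :=
  ContDiff ℝ ∞ η ∧ HasCompactSupport η ∧ tsupport η ⊆ Ioo a b

/-- `v` is the weak derivative of `u` on `(a,b)`: `∫ η' u = - ∫ η v` for all test functions `η`. -/
def IsWeakDeriv {n : ℕ} {a b : ℝ} (u v : L2 n a b) : Prop :=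
  ∀ η : ℝ → ℝ, IsTest a b η →
    ∫ t in Ioo a b, deriv η t • u t = - ∫ t in Ioo a b, η t • v t

lemma integrable_smul_L2 {n : ℕ} {a b : ℝ} {θ : ℝ → ℝ} (hc : Continuous θ)
    (hs : HasCompactSupport θ) (u : L2 n a b) :
    IntegrableOn (fun t => θ t • u t) (Ioo a b) := by
  have hu : Integrable u ((volume : Measure ℝ).restrict (Ioo a b)) :=
    (Lp.memLp u).integrable (by norm_num)
  obtain ⟨C, hC⟩ := hc.bounded_above_of_compact_support hs
  exact hu.bdd_smul C hc.aestronglyMeasurable (Filter.Eventually.of_forall hC)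

lemma IsTest.integrable_smul {n : ℕ} {a b : ℝ} {η : ℝ → ℝ} (h : IsTest a b η) (u : L2 n a b) :
    IntegrableOn (fun t => η t • u t) (Ioo a b) :=
  integrable_smul_L2 h.1.continuous h.2.1 u

lemma IsTest.integrable_deriv_smul {n : ℕ} {a b : ℝ} {η : ℝ → ℝ} (h : IsTest a b η)
    (u : L2 n a b) : IntegrableOn (fun t => deriv η t • u t) (Ioo a b) :=
  integrable_smul_L2 (h.1.continuous_deriv (by simp)) h.2.1.deriv u

lemma integral_smul_add {n : ℕ} {a b : ℝ} {θ : ℝ → ℝ} (u v : L2 n a b)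
    (hu : IntegrableOn (fun t => θ t • u t) (Ioo a b))
    (hv : IntegrableOn (fun t => θ t • v t) (Ioo a b)) :
    ∫ t in Ioo a b, θ t • (u + v : L2 n a b) t =
      (∫ t in Ioo a b, θ t • u t) + ∫ t in Ioo a b, θ t • v t := by
  rw [← integral_add hu hv]
  refine integral_congr_ae ?_
  filter_upwards [Lp.coeFn_add u v] with t ht
  rw [ht, Pi.add_apply, smul_add]

lemma integral_smul_smul {n : ℕ} {a b : ℝ} {θ : ℝ → ℝ} (c : ℝ) (u : L2 n a b) :
    ∫ t in Ioo a b, θ t • (c • u : L2 n a b) t = c • ∫ t in Ioo a b, θ t • u t := by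
  rw [← integral_smul]
  refine integral_congr_ae ?_
  filter_upwards [Lp.coeFn_smul c u] with t ht
  rw [ht, Pi.smul_apply, smul_comm]

lemma integral_smul_zero {n : ℕ} {a b : ℝ} {θ : ℝ → ℝ} :
    ∫ t in Ioo a b, θ t • (0 : L2 n a b) t = 0 := by
  simpa using integral_smul_smul (θ := θ) 0 (0 : L2 n a b)

/-- The Sobolev space `H¹(a,b;ℝⁿ)` as a subspace of `L² × L²`: all pairs of a function `u ∈ L²` and its weak derivative
`u̇ ∈ L²`. The second component is determined by the first one. The norm induced by the
`ℓ²`-product is the usual one, `(‖u‖² + ‖u̇‖²)^(1/2)`. -/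
def H1Sub (n : ℕ) (a b : ℝ) : Submodule ℝ (WithLp 2 (L2 n a b × L2 n a b)) where
  carrier := {p | IsWeakDeriv p.fst p.snd}
  zero_mem' := by
    intro η _
    rw [WithLp.zero_fst, WithLp.zero_snd, integral_smul_zero, integral_smul_zero, neg_zero]
  add_mem' := by
    intro p q hp hq η hη
    rw [WithLp.add_fst, WithLp.add_snd,
      integral_smul_add _ _ (hη.integrable_deriv_smul _) (hη.integrable_deriv_smul _),
      integral_smul_add _ _ (hη.integrable_smul _) (hη.integrable_smul _),
      hp η hη, hq η hη, neg_add]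
  smul_mem' := by
    intro c p hp η hη
    rw [WithLp.smul_fst, WithLp.smul_snd, integral_smul_smul, integral_smul_smul,
      hp η hη, smul_neg]

/-- The Sobolev space `H¹(a,b;ℝⁿ)` as a normed space. -/
abbrev H1 (n : ℕ) (a b : ℝ) : Type := H1Sub n a b

/-- The function `u ∈ L²` underlying an element of `H¹`. -/
def H1.fn {n : ℕ} {a b : ℝ} (u : H1 n a b) : L2 n a b := u.1.fst

/-- The weak time derivative `u̇ ∈ L²` of an element of `H¹`. -/
def H1.dt {n : ℕ} {a b : ℝ} (u : H1 n a b) : L2 n a b := u.1.snd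

/-- The restriction `L²(a,b;ℝⁿ) → L²(c,d;ℝⁿ)` to a subinterval `(c,d) ⊆ (a,b)`. -/
noncomputable def L2.restrict {n : ℕ} {a b c d : ℝ} (h : Ioo c d ⊆ Ioo a b) (u : L2 n a b) :
    L2 n c d :=
  ((Lp.memLp u).mono_measure (Measure.restrict_mono h le_rfl)).toLp u

/-- `x ∈ H¹(-b,T;ℝⁿ)` solves the delay equation
`ẋ(t) + f(x(t)) = A x(t-τ) + g(t)` a.e. in `(0,T)`, with `x = φ` in `[-b,0]`.
(Elements of `H¹` are continuous, so the second condition may be read a.e.) -/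
structure IsSolution {n : ℕ} {b T : ℝ} (f : Vec n → Vec n) (A : Matrix (Fin n) (Fin n) ℝ)
    (g : L2 n 0 T) (φ : H1 n (-b) 0) (τ : ℝ) (x : H1 n (-b) T) : Prop where
  eqn : ∀ᵐ t, t ∈ Ioo 0 T → x.dt t + f (x.fn t) = A.toEuclideanLin (x.fn (t - τ)) + g t
  init : ∀ᵐ t, t ∈ Ioo (-b) 0 → x.fn t = φ.fn t

/-- `w ∈ H¹(-b,T;ℝⁿ)` solves the linear delay equation
`ẇ(t) + Df(x(t)) w(t) = A w(t-τ) - A ẋ(t-τ)` a.e. in `(0,T)`, with `w = 0` in `[-b,0]`. -/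
structure IsSensitivity {n : ℕ} {b T : ℝ} (f : Vec n → Vec n) (A : Matrix (Fin n) (Fin n) ℝ)
    (τ : ℝ) (x w : H1 n (-b) T) : Prop where
  eqn : ∀ᵐ t, t ∈ Ioo 0 T →
    w.dt t + fderiv ℝ f (x.fn t) (w.fn t) =
      A.toEuclideanLin (w.fn (t - τ)) - A.toEuclideanLin (x.dt (t - τ))
  init : ∀ᵐ t, t ∈ Ioo (-b) 0 → w.fn t = 0

end DelayEq

namespace DelayEq

open MeasureTheory Set Filter
open scoped ContDiff Topology NNReal ENNReal

set_option linter.unusedSectionVars false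

/-! ### Square-integrable functions on the line: primitives, cut-off, translation. -/

section

variable {E F : Type*} [NormedAddCommGroup E] [NormedSpace ℝ E]
  [NormedAddCommGroup F] [NormedSpace ℝ F]

/-! The unknown is not `x` but its derivative `v = ẋ`, extended by zero to all of `ℝ`. The history
fixes `p = x(0)`, so that `x = p + ∫₀ v`, and the delay equation becomes `v = c + 1_(0,T) (A x(·-τ)
- f(x))` in `L²(ℝ)`. Here `c` is `φ̇` on `(-b,0)`, `g` on `(0,T)` and zero elsewhere. Both the space
and the constant `p` are then independent of `τ`, and `v ↦ x` is affine and continuous into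
`H¹(-b,T)`, so everything about `x[τ]` follows from the same statement about `v[τ]`.

Existence and uniqueness: for Lipschitz `f` the right-hand side is a causal (Volterra) map, so a
high iterate is a contraction (`existsUnique_eq_add_cut`). For general `f`, the condition on `Df`
gives `⟨f(x) - f(0), x⟩ ≥ -λ‖x‖²`. This estimate yields an a priori bound by an energy argument
(`exists_norm_state_le`), and it survives multiplying `f - f(0)` by a cut-off function. Hence `f`
and a Lipschitz truncation of it have the same solutions (`existsUnique_delay`).

Dependence on `τ`: the implicit function theorem is applied to the residual `G(τ,v) = v - c -
1_(0,T) (A x(·-τ) - f(x))`. The essential point is that `(τ,v) ↦ 1_(0,T) (∫₀ v)(·-τ)` is strictly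
differentiable in `L²`, although `v` is merely `L²`: its `τ`-derivative is `-1_(0,T) v(·-τ)`, and
translation is strongly continuous on `L²` (`hasStrictFDerivAt_cutPrim`). The superposition with `f`
is strictly differentiable because `∫₀ v` is controlled uniformly on `[0,T]`
(`hasStrictFDerivAt_cut_comp_state`). The partial derivative in `v` is again identity minus a causal
Lipschitz map, hence invertible (`linResidual_isInvertible`). Differentiating `G(τ, v[τ]) = 0` gives
the sensitivity equation. The derivatives in `τ` and `t` commute since `u ↦ u̇` is a continuous
linear map from `H¹` to `L²`. -/

/-- The space `L²(ℝ;E)`. -/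
abbrev L2R (E : Type*) [NormedAddCommGroup E] : Type _ := Lp E 2 (volume : Measure ℝ)

lemma L2R.locallyIntegrable (v : L2R E) : LocallyIntegrable v volume :=
  (Lp.memLp v).locallyIntegrable (by norm_num)

lemma L2R.integrableOn_Ioc (v : L2R E) (a b : ℝ) : IntegrableOn v (Ioc a b) volume :=
  (v.locallyIntegrable.integrableOn_isCompact isCompact_Icc).mono_set Ioc_subset_Icc_self

lemma L2R.intervalIntegrable (v : L2R E) (a b : ℝ) : IntervalIntegrable v volume a b :=
  ⟨v.integrableOn_Ioc a b, v.integrableOn_Ioc b a⟩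

lemma L2R.setIntegral_norm_le (v : L2R E) {a b : ℝ} (hab : a ≤ b) :
    ∫ s in Ioc a b, ‖v s‖ ≤ √(b - a) * ‖v‖ := by
  have h1 : eLpNorm v 1 (volume.restrict (Ioc a b)) ≤
      eLpNorm v 2 volume * ENNReal.ofReal (√(b - a)) := by
    refine (eLpNorm_le_eLpNorm_mul_rpow_measure_univ (q := 2) (by norm_num)
      (Lp.aestronglyMeasurable v).restrict).trans ?_
    gcongr
    · exact Measure.restrict_le_self
    · rw [Measure.restrict_apply_univ, Real.volume_Ioc, ENNReal.ofReal_rpow_of_nonneg (by linarith)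
        (by norm_num), Real.sqrt_eq_rpow]
      norm_num
  rw [integral_norm_eq_lintegral_enorm (Lp.aestronglyMeasurable v).restrict,
    ← eLpNorm_one_eq_lintegral_enorm, Lp.norm_def, mul_comm,
    ← ENNReal.toReal_ofReal (Real.sqrt_nonneg (b - a)), ← ENNReal.toReal_mul]
  exact ENNReal.toReal_mono (ENNReal.mul_ne_top (Lp.eLpNorm_ne_top v) ENNReal.ofReal_ne_top) h1

lemma L2R.norm_intervalIntegral_le (v : L2R E) (a b : ℝ) :
    ‖∫ s in a..b, v s‖ ≤ √|b - a| * ‖v‖ := by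
  refine intervalIntegral.norm_integral_le_integral_norm_uIoc.trans ?_
  refine (v.setIntegral_norm_le (min_le_max)).trans_eq ?_
  rw [max_sub_min_eq_abs]

/-- The primitive `t ↦ ∫₀ᵗ v` of an `L²` function, as a linear map into the continuous functions. -/
noncomputable def prim : L2R E →ₗ[ℝ] C(ℝ, E) where
  toFun v := ⟨fun t => ∫ s in (0 : ℝ)..t, v s,
    intervalIntegral.continuous_primitive v.intervalIntegrable 0⟩
  map_add' u v := by
    ext t
    simp only [ContinuousMap.coe_mk, ContinuousMap.add_apply]
    rw [← intervalIntegral.integral_add (u.intervalIntegrable _ _) (v.intervalIntegrable _ _)]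
    refine intervalIntegral.integral_congr_ae ?_
    filter_upwards [Lp.coeFn_add u v] with s hs _
    rw [hs, Pi.add_apply]
  map_smul' c v := by
    ext t
    simp only [ContinuousMap.coe_mk, ContinuousMap.smul_apply, RingHom.id_apply]
    rw [← intervalIntegral.integral_smul]
    refine intervalIntegral.integral_congr_ae ?_
    filter_upwards [Lp.coeFn_smul c v] with s hs _
    rw [hs, Pi.smul_apply]

lemma prim_apply (v : L2R E) (t : ℝ) : prim v t = ∫ s in (0 : ℝ)..t, v s := rfl

@[simp] lemma prim_apply_zero (v : L2R E) : prim v 0 = 0 := by simp [prim_apply]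

lemma prim_sub_prim (v : L2R E) (s t : ℝ) : prim v t - prim v s = ∫ r in s..t, v r :=
  intervalIntegral.integral_interval_sub_left (v.intervalIntegrable _ _) (v.intervalIntegrable _ _)

lemma norm_prim_sub_le (v : L2R E) (s t : ℝ) : ‖prim v t - prim v s‖ ≤ √|t - s| * ‖v‖ := by
  rw [prim_sub_prim]
  exact v.norm_intervalIntegral_le s t

lemma norm_prim_le (v : L2R E) (t : ℝ) : ‖prim v t‖ ≤ √|t| * ‖v‖ := by
  simpa using norm_prim_sub_le v 0 t

lemma prim_congr {u v : L2R E} {a b t : ℝ} (h : ∀ᵐ s, s ∈ Ioo a b → u s = v s)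
    (ha : a ≤ 0) (hb : 0 ≤ b) (ht : t ∈ Icc a b) : prim u t = prim v t := by
  rw [prim_apply, prim_apply]
  refine intervalIntegral.integral_congr_ae ?_
  have ha' : ∀ᵐ s : ℝ, s ≠ a := by simp [ae_iff, measure_singleton]
  have hb' : ∀ᵐ s : ℝ, s ≠ b := by simp [ae_iff, measure_singleton]
  filter_upwards [h, ha', hb'] with s hs hsa hsb hst
  refine hs ⟨lt_of_le_of_ne ?_ hsa.symm, lt_of_le_of_ne ?_ hsb⟩
  · rw [mem_uIoc] at hst
    rcases hst with h | h <;> linarith [ht.1, ht.2, h.1, h.2]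
  · rw [mem_uIoc] at hst
    rcases hst with h | h <;> linarith [ht.1, ht.2, h.1, h.2]

/-- This is the source of causality: values at all times `s` up to `t`, delayed negative ones
included, are controlled by `v` on `(a,t]` alone. The left end `a ≤ 0` makes room for the delay. -/
lemma norm_prim_le_integral (v : L2R E) {a s t : ℝ} (ha : a ≤ 0) (ht : 0 ≤ t) (hs : s ∈ Icc a t) :
    ‖prim v s‖ ≤ ∫ r in Ioc a t, ‖v r‖ := by
  rw [prim_apply]
  refine intervalIntegral.norm_integral_le_integral_norm_uIoc.trans ?_
  refine setIntegral_mono_set (v.integrableOn_Ioc a t).norm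
    (Eventually.of_forall fun _ => norm_nonneg _) (Eventually.of_forall ?_)
  exact Ioc_subset_Ioc (le_min ha hs.1) (max_le ht hs.2)

lemma memLp_indicator_Ioo (a b : ℝ) (h : C(ℝ, E)) :
    MemLp ((Ioo a b).indicator h) 2 (volume : Measure ℝ) := by
  rw [memLp_indicator_iff_restrict measurableSet_Ioo]
  obtain ⟨C, hC⟩ := (isCompact_Icc (a := a) (b := b)).exists_bound_of_continuousOn
    h.continuous.continuousOn
  refine MemLp.of_bound h.continuous.aestronglyMeasurable.restrict C ?_
  filter_upwards [ae_restrict_mem measurableSet_Ioo] with t ht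
  exact hC t (Ioo_subset_Icc_self ht)

/-- The `L²` function which is `h` on `(a,b)` and `0` elsewhere. -/
noncomputable def cut (a b : ℝ) : C(ℝ, E) →ₗ[ℝ] L2R E where
  toFun h := (memLp_indicator_Ioo a b h).toLp _
  map_add' h k := by
    rw [← MemLp.toLp_add]
    congr 1
    simp only [ContinuousMap.coe_add, indicator_add']
  map_smul' c h := by
    rw [RingHom.id_apply, ← MemLp.toLp_const_smul]
    congr 1
    rw [ContinuousMap.coe_smul]
    exact indicator_const_smul (Ioo a b) c (h : ℝ → E)

lemma coeFn_cut (a b : ℝ) (h : C(ℝ, E)) : cut a b h =ᵐ[volume] (Ioo a b).indicator h :=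
  (memLp_indicator_Ioo a b h).coeFn_toLp

lemma norm_cut_le {a b : ℝ} (h : C(ℝ, E)) {C : ℝ} (hC : ∀ t ∈ Ioo a b, ‖h t‖ ≤ C)
    (hC0 : 0 ≤ C) : ‖cut a b h‖ ≤ √(b - a) * C := by
  rcases le_total b a with hab | hab
  · have : cut a b h = 0 := by
      refine (Lp.eq_zero_iff_ae_eq_zero).2 ((coeFn_cut a b h).trans ?_)
      rw [Ioo_eq_empty (not_lt.2 hab), indicator_empty]
      rfl
    rw [this, norm_zero]
    positivity
  have h1 : eLpNorm ((Ioo a b).indicator h) 2 (volume : Measure ℝ) ≤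
      ENNReal.ofReal (√(b - a)) * ENNReal.ofReal C := by
    rw [eLpNorm_indicator_eq_eLpNorm_restrict measurableSet_Ioo]
    refine (eLpNorm_le_of_ae_bound (C := C) ?_).trans_eq ?_
    · filter_upwards [ae_restrict_mem measurableSet_Ioo] with t ht
      exact hC t ht
    · rw [Measure.restrict_apply_univ, Real.volume_Ioo, ENNReal.ofReal_rpow_of_nonneg (by linarith)
        (by norm_num), Real.sqrt_eq_rpow]
      norm_num
  rw [cut, LinearMap.coe_mk, AddHom.coe_mk, Lp.norm_toLp]
  refine ENNReal.toReal_le_of_le_ofReal (by positivity) ?_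
  rwa [ENNReal.ofReal_mul (by positivity)]

/-- The translation by `τ` in the argument. -/
def delay (τ : ℝ) : C(ℝ, E) →ₗ[ℝ] C(ℝ, E) where
  toFun h := h.comp ⟨fun t => t - τ, by fun_prop⟩
  map_add' _ _ := rfl
  map_smul' _ _ := rfl

@[simp] lemma delay_apply (τ : ℝ) (h : C(ℝ, E)) (t : ℝ) : delay τ h t = h (t - τ) := rfl

/-- The translation by `τ` on `L²(ℝ;E)`. -/
noncomputable def translate (τ : ℝ) (v : L2R E) : L2R E :=
  Lp.compMeasurePreserving (fun t : ℝ => t - τ) (measurePreserving_sub_right volume τ) v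

lemma coeFn_translate (τ : ℝ) (v : L2R E) : translate τ v =ᵐ[volume] fun t => v (t - τ) :=
  Lp.coeFn_compMeasurePreserving v _

/-- Strong continuity of translations, jointly with the function. It makes the delay term strictly
differentiable in `L²` with no regularity of `v`. -/
lemma continuous_translate : Continuous fun p : ℝ × L2R E => translate p.1 p.2 := by
  have hg : Continuous fun p : ℝ × L2R E => (⟨fun t => t - p.1, by fun_prop⟩ : C(ℝ, ℝ)) :=
    ContinuousMap.continuous_of_continuous_uncurry _ (by
      simp only [Function.uncurry_def, ContinuousMap.coe_mk]
      fun_prop)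
  exact Continuous.compMeasurePreservingLp continuous_snd hg
    (fun p => measurePreserving_sub_right volume p.1) (by norm_num)

end

/-! ### Absolute continuity, and weak derivatives as derivatives of primitives. -/

section

section AbsolutelyContinuous

variable {X Y : Type*} [PseudoMetricSpace X] [PseudoMetricSpace Y]

lemma absolutelyContinuousOnInterval_of_dist_le {f : ℝ → X} {g : ℝ → Y} {a b : ℝ} {C : ℝ}
    (hf : AbsolutelyContinuousOnInterval f a b)
    (h : ∀ s ∈ uIcc a b, ∀ t ∈ uIcc a b, dist (g s) (g t) ≤ C * dist (f s) (f t)) :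
    AbsolutelyContinuousOnInterval g a b := by
  unfold AbsolutelyContinuousOnInterval at hf ⊢
  refine squeeze_zero' (Eventually.of_forall fun I => Finset.sum_nonneg fun i _ => dist_nonneg) ?_
    (by simpa using hf.const_mul C)
  refine mem_inf_of_right ?_
  rw [mem_principal]
  intro I hI
  simp only [mem_ofPred_eq, Finset.mul_sum]
  exact Finset.sum_le_sum fun i hi => h _ (hI.1 i hi).1 _ (hI.1 i hi).2

end AbsolutelyContinuous

variable {E F : Type*} [NormedAddCommGroup E] [NormedSpace ℝ E]
  [NormedAddCommGroup F] [NormedSpace ℝ F]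

/-- The increments are dominated by those of the scalar primitive of `‖v‖`, which is absolutely
continuous. -/
lemma absolutelyContinuousOnInterval_primitive {v : ℝ → E} {a b : ℝ}
    (hv : IntervalIntegrable v volume a b) :
    AbsolutelyContinuousOnInterval (fun t => ∫ s in a..t, v s) a b := by
  refine absolutelyContinuousOnInterval_of_dist_le (C := 1)
    (hv.norm.absolutelyContinuousOnInterval_intervalIntegral left_mem_uIcc) ?_
  intro s hs t ht
  have hi : ∀ r ∈ uIcc a b, IntervalIntegrable v volume a r := fun r hr =>
    hv.mono_set (uIcc_subset_uIcc_left hr)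
  rw [one_mul, dist_eq_norm, dist_eq_norm,
    intervalIntegral.integral_interval_sub_left (hi s hs) (hi t ht),
    intervalIntegral.integral_interval_sub_left (hi s hs).norm (hi t ht).norm, Real.norm_eq_abs]
  exact intervalIntegral.norm_integral_le_abs_integral_norm

/-- The difference of `f` and the primitive of `f'` is absolutely continuous with derivative zero
a.e., hence constant. -/
lemma integral_eq_sub_of_absolutelyContinuousOnInterval [CompleteSpace E] {f f' : ℝ → E} {a b : ℝ}
    (hf : AbsolutelyContinuousOnInterval f a b) (hf' : IntervalIntegrable f' volume a b)
    (h : ∀ᵐ x, x ∈ uIcc a b → HasDerivAt f (f' x) x) :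
    ∫ x in a..b, f' x = f b - f a := by
  have hg := hf.sub (absolutelyContinuousOnInterval_primitive hf')
  obtain ⟨C, hC⟩ := hg.const_of_ae_hasDerivAt_zero (by
    filter_upwards [h, hf'.ae_hasDerivAt_integral] with x h1 h2 hx
    simpa using (h1 hx).sub (h2 hx a left_mem_uIcc))
  have ha := hC a left_mem_uIcc
  have hb := hC b right_mem_uIcc
  simp only [Pi.sub_apply, intervalIntegral.integral_same, sub_zero] at ha hb
  rw [ha, ← hb]
  abel

lemma absolutelyContinuousOnInterval_prim (v : L2R E) (a b : ℝ) :
    AbsolutelyContinuousOnInterval (prim v) a b := by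
  refine absolutelyContinuousOnInterval_of_dist_le (C := 1)
    (absolutelyContinuousOnInterval_primitive (v.intervalIntegrable a b)) ?_
  intro s _ t _
  rw [one_mul, dist_eq_norm, dist_eq_norm, prim_sub_prim,
    intervalIntegral.integral_interval_sub_left (v.intervalIntegrable _ _)
      (v.intervalIntegrable _ _)]

lemma ae_hasDerivAt_prim [CompleteSpace E] (v : L2R E) :
    ∀ᵐ t, HasDerivAt (prim v) (v t) t := by
  filter_upwards [LocallyIntegrable.ae_hasDerivAt_integral v.locallyIntegrable] with t ht
  exact ht 0

/-- Extension by zero `L²(a,b;E) → L²(ℝ;E)`. -/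
noncomputable def extend {a b : ℝ} (u : Lp E 2 ((volume : Measure ℝ).restrict (Ioo a b))) :
    L2R E :=
  ((memLp_indicator_iff_restrict measurableSet_Ioo).2 (Lp.memLp u)).toLp _

lemma coeFn_extend {a b : ℝ} (u : Lp E 2 ((volume : Measure ℝ).restrict (Ioo a b))) :
    extend u =ᵐ[volume] (Ioo a b).indicator u :=
  MemLp.coeFn_toLp _

lemma extend_apply_of_mem {a b : ℝ} (u : Lp E 2 ((volume : Measure ℝ).restrict (Ioo a b))) :
    ∀ᵐ t, t ∈ Ioo a b → extend u t = u t := by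
  filter_upwards [coeFn_extend u] with t ht h
  rw [ht, indicator_of_mem h]

lemma extend_apply_of_notMem {a b : ℝ} (u : Lp E 2 ((volume : Measure ℝ).restrict (Ioo a b))) :
    ∀ᵐ t, t ∉ Ioo a b → extend u t = 0 := by
  filter_upwards [coeFn_extend u] with t ht h
  rw [ht, indicator_of_notMem h]

/-- Integration by parts: `η • (q + prim v)` is absolutely continuous and vanishes at both ends. -/
lemma integral_deriv_smul_prim [CompleteSpace E] (v : L2R E) (q : E) {a b : ℝ} {η : ℝ → ℝ}
    (hη : IsTest a b η) :
    ∫ t in Ioo a b, deriv η t • (q + prim v t) = - ∫ t in Ioo a b, η t • v t := by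
  rcases le_or_gt b a with hab | hab
  · simp [Ioo_eq_empty (not_lt.2 hab)]
  have hηa : η a = 0 := image_eq_zero_of_notMem_tsupport fun h => lt_irrefl _ (hη.2.2 h).1
  have hηb : η b = 0 := image_eq_zero_of_notMem_tsupport fun h => lt_irrefl _ (hη.2.2 h).2
  have hd : Continuous (deriv η) := hη.1.continuous_deriv (by simp)
  have h1 : AbsolutelyContinuousOnInterval η a b :=
    (hη.1.of_le (by simp)).contDiffOn.absolutelyContinuousOnInterval
  have h2 : AbsolutelyContinuousOnInterval (fun t => q + prim v t) a b :=
    absolutelyContinuousOnInterval_of_dist_le (C := 1)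
      (absolutelyContinuousOnInterval_prim v a b) (fun s _ t _ => by simp)
  have i1 : IntervalIntegrable (fun t => deriv η t • (q + prim v t)) volume a b :=
    (hd.smul (continuous_const.add (prim v).continuous)).intervalIntegrable _ _
  have i2 : IntervalIntegrable (fun t => η t • v t) volume a b :=
    (v.intervalIntegrable a b).continuousOn_smul hη.1.continuous.continuousOn
  have := integral_eq_sub_of_absolutelyContinuousOnInterval (h1.fun_smul h2)
    (f' := fun t => η t • v t + deriv η t • (q + prim v t)) (i2.add i1) (by
      filter_upwards [ae_hasDerivAt_prim v] with t ht _
      exact ((hη.1.differentiable (by simp)) t).hasDerivAt.smul (ht.const_add q))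
  rw [intervalIntegral.integral_add i2 i1, hηa, hηb, zero_smul, zero_smul, sub_zero,
    intervalIntegral.integral_of_le hab.le, intervalIntegral.integral_of_le hab.le,
    integral_Ioc_eq_integral_Ioo, integral_Ioc_eq_integral_Ioo] at this
  exact eq_neg_of_add_eq_zero_right this

/-- The test function with derivative `θ`, for `θ` of vanishing mean. -/
lemma exists_isTest_deriv_eq {a b : ℝ} {θ : ℝ → ℝ} (hθ : IsTest a b θ)
    (h0 : ∫ t, θ t = 0) : ∃ η, IsTest a b η ∧ deriv η = θ := by
  rcases (tsupport θ).eq_empty_or_nonempty with he | hne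
  · refine ⟨θ, hθ, ?_⟩
    rw [tsupport_eq_empty_iff.1 he]
    ext t
    simp
  obtain ⟨α, hα, hα'⟩ := hθ.2.1.exists_isLeast hne
  obtain ⟨β, hβ, hβ'⟩ := hθ.2.1.exists_isGreatest hne
  have hz : ∀ t, t ∉ Icc α β → θ t = 0 := fun t ht =>
    image_eq_zero_of_notMem_tsupport fun h => ht ⟨hα' h, hβ' h⟩
  have hd : ∀ t, HasDerivAt (fun t => ∫ s in a..t, θ s) (θ t) t := fun t =>
    hθ.1.continuous.integral_hasStrictDerivAt a t |>.hasDerivAt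
  have hderiv : deriv (fun t => ∫ s in a..t, θ s) = θ := funext fun t => (hd t).deriv
  -- The primitive vanishes left of `supp θ` trivially, and right of it because the full integral of
  -- `θ` is zero.
  have hsupp : tsupport (fun t => ∫ s in a..t, θ s) ⊆ Icc α β := by
    refine closure_minimal ?_ isClosed_Icc
    intro t ht
    by_contra hn
    apply ht
    rcases lt_or_ge t α with h | h
    · refine intervalIntegral.integral_zero_ae (Eventually.of_forall fun s hs => hz s fun h' => ?_)
      have := (hθ.2.2 hα).1
      rcases mem_uIoc.1 hs with h2 | h2 <;> linarith [h2.1, h2.2, h'.1]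
    · have hβt : β < t := by
        by_contra h'
        exact hn ⟨h, not_lt.1 h'⟩
      have haβ : a < β := (hθ.2.2 hβ).1
      have haα : a < α := (hθ.2.2 hα).1
      beta_reduce
      rw [intervalIntegral.integral_of_le (by linarith), ← h0]
      refine setIntegral_eq_integral_of_forall_compl_eq_zero fun s hs => hz s fun h' => hs ?_
      exact ⟨by linarith [h'.1], by linarith [h'.2]⟩
  refine ⟨fun t => ∫ s in a..t, θ s, ⟨?_, ?_, ?_⟩, hderiv⟩
  · rw [contDiff_infty_iff_deriv]
    exact ⟨fun t => (hd t).differentiableAt, by rw [hderiv]; exact hθ.1⟩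
  · exact HasCompactSupport.of_support_subset_isCompact isCompact_Icc
      (subset_closure.trans hsupp)
  · exact hsupp.trans fun t ht => ⟨(hθ.2.2 hα).1.trans_le ht.1, ht.2.trans_lt (hθ.2.2 hβ).2⟩

lemma exists_isTest_integral_eq_one {a b : ℝ} (hab : a < b) :
    ∃ ρ, IsTest a b ρ ∧ ∫ t, ρ t = 1 := by
  let φ : ContDiffBump ((a + b) / 2) := ⟨(b - a) / 8, (b - a) / 4, by linarith, by linarith⟩
  refine ⟨φ.normed volume, ⟨φ.contDiff_normed, φ.hasCompactSupport_normed, ?_⟩, φ.integral_normed⟩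
  rw [φ.tsupport_normed_eq, Real.closedBall_eq_Icc]
  intro t ht
  have h1 : φ.rOut = (b - a) / 4 := rfl
  rw [h1] at ht
  constructor <;> linarith [ht.1, ht.2]

lemma IsTest.sub_smul {a b : ℝ} {θ ρ : ℝ → ℝ} (hθ : IsTest a b θ) (hρ : IsTest a b ρ) (c : ℝ) :
    IsTest a b (fun t => θ t - c * ρ t) := by
  have hs : tsupport (fun t => θ t - c * ρ t) ⊆ tsupport θ ∪ tsupport ρ := by
    refine closure_minimal ?_ ((isClosed_tsupport _).union (isClosed_tsupport _))
    intro t ht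
    by_contra hn
    rw [mem_union, not_or] at hn
    apply ht
    simp [image_eq_zero_of_notMem_tsupport hn.1, image_eq_zero_of_notMem_tsupport hn.2]
  exact ⟨hθ.1.sub (contDiff_const.mul hρ.1),
    HasCompactSupport.of_support_subset_isCompact (hθ.2.1.isCompact.union hρ.2.1.isCompact)
      (subset_closure.trans hs), hs.trans (union_subset hθ.2.2 hρ.2.2)⟩

/-- **Du Bois-Reymond**: a function all of whose weak derivatives vanish is constant. -/
lemma ae_eq_const_of_integral_deriv_smul_eq_zero [CompleteSpace E] {a b : ℝ} (hab : a < b)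
    {W : ℝ → E} (hW : IntegrableOn W (Ioo a b))
    (h : ∀ η, IsTest a b η → ∫ t in Ioo a b, deriv η t • W t = 0) :
    ∃ q, ∀ᵐ t, t ∈ Ioo a b → W t = q := by
  obtain ⟨ρ, hρ, hρ1⟩ := exists_isTest_integral_eq_one hab
  have hint : ∀ θ, IsTest a b θ → IntegrableOn (fun t => θ t • W t) (Ioo a b) := by
    intro θ hθ
    obtain ⟨C, hC⟩ := hθ.1.continuous.bounded_above_of_compact_support hθ.2.1
    exact hW.bdd_smul C hθ.1.continuous.aestronglyMeasurable (Eventually.of_forall hC)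
  have hset : ∀ θ, IsTest a b θ → ∫ t in Ioo a b, θ t = ∫ t, θ t := fun θ hθ =>
    setIntegral_eq_integral_of_forall_compl_eq_zero fun t ht =>
      image_eq_zero_of_notMem_tsupport fun h' => ht (hθ.2.2 h')
  have hi : ∀ θ, IsTest a b θ → Integrable θ := fun θ hθ =>
    hθ.1.continuous.integrable_of_hasCompactSupport hθ.2.1
  refine ⟨∫ t in Ioo a b, ρ t • W t, ?_⟩
  have key := isOpen_Ioo.ae_eq_zero_of_integral_contDiff_smul_eq_zero (μ := volume) (U := Ioo a b)
    (f := fun t => (Ioo a b).indicator (fun t => W t - ∫ s in Ioo a b, ρ s • W s) t) (by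
      refine (IntegrableOn.integrable_indicator ?_ measurableSet_Ioo).locallyIntegrable
        |>.locallyIntegrableOn _
      exact hW.sub (integrableOn_const (by simp))) ?_
  · filter_upwards [key] with t ht hm
    have := ht hm
    rw [indicator_of_mem hm] at this
    exact sub_eq_zero.1 this
  intro θ h1 h2 h3
  have hθ : IsTest a b θ := ⟨h1, h2, h3⟩
  -- Subtracting `(∫ θ) ρ` gives mean zero, so `θ - (∫ θ) ρ` is the derivative of a test function;
  -- testing with it moves `(∫ θ) ρ` into the constant `∫ ρ W`.
  obtain ⟨η, hη, hd⟩ := exists_isTest_deriv_eq (hθ.sub_smul hρ (∫ t, θ t)) (by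
    rw [integral_sub (hi θ hθ) ((hi ρ hρ).const_mul _), integral_const_mul, hρ1, mul_one, sub_self])
  have e1 := h η hη
  rw [hd] at e1
  simp only [sub_smul, mul_smul] at e1
  rw [integral_sub (hint θ hθ) ((hint ρ hρ).fun_smul _), integral_smul] at e1
  have e2 : ∀ t, θ t • (Ioo a b).indicator (fun t => W t - ∫ s in Ioo a b, ρ s • W s) t =
      (Ioo a b).indicator (fun t => θ t • W t - θ t • ∫ s in Ioo a b, ρ s • W s) t := by
    intro t
    by_cases ht : t ∈ Ioo a b
    · simp [indicator_of_mem ht, smul_sub]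
    · simp [indicator_of_notMem ht]
  simp_rw [e2]
  rw [integral_indicator measurableSet_Ioo, integral_sub (hint θ hθ)
    ((hi θ hθ).integrableOn.smul_const _), integral_smul_const, hset θ hθ]
  exact e1

/-- An `H¹` function is, up to a constant, the primitive of its weak derivative. -/
lemma H1.exists_fn_eq_add_prim {n : ℕ} {a b : ℝ} (hab : a < b) (u : H1 n a b) :
    ∃ q, ∀ᵐ t, t ∈ Ioo a b → u.fn t = q + prim (extend u.dt) t := by
  have hi : IntegrableOn (u.fn : ℝ → Vec n) (Ioo a b) := (Lp.memLp u.fn).integrable (by norm_num)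
  have hp : ∀ v : L2R (Vec n), IntegrableOn (prim v) (Ioo a b) := fun v =>
    ((prim v).continuous.integrableOn_Icc (a := a) (b := b)).mono_set Ioo_subset_Icc_self
  obtain ⟨q, hq⟩ := ae_eq_const_of_integral_deriv_smul_eq_zero hab
    (W := fun t => u.fn t - prim (extend u.dt) t) (hi.sub (hp _)) (by
      intro η hη
      have hw : ∫ t in Ioo a b, deriv η t • u.fn t = - ∫ t in Ioo a b, η t • u.dt t := u.2 η hη
      have hw2 := integral_deriv_smul_prim (extend u.dt) 0 hη
      simp only [zero_add] at hw2
      simp only [smul_sub]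
      rw [integral_sub (hη.integrable_deriv_smul _), hw, hw2, sub_eq_zero, neg_inj]
      · refine setIntegral_congr_ae measurableSet_Ioo ?_
        filter_upwards [extend_apply_of_mem u.dt] with t ht hm
        rw [ht hm]
      · exact (((hη.1.continuous_deriv (by simp)).smul (prim _).continuous).integrableOn_Icc
          (a := a) (b := b)).mono_set Ioo_subset_Icc_self)
  refine ⟨q, ?_⟩
  filter_upwards [hq] with t ht hm
  rw [← ht hm, sub_add_cancel]

end

/-! ### Unique fixed points of causal Lipschitz maps. -/

section

variable {E F : Type*} [NormedAddCommGroup E] [NormedSpace ℝ E]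
  [NormedAddCommGroup F] [NormedSpace ℝ F]

lemma cut_congr {a b : ℝ} {h h' : C(ℝ, E)} (hh : ∀ t ∈ Ioo a b, h t = h' t) :
    cut a b h = cut a b h' := by
  refine Lp.ext ((coeFn_cut a b h).trans (EventuallyEq.trans ?_ (coeFn_cut a b h').symm))
  exact Eventually.of_forall fun t => by
    by_cases ht : t ∈ Ioo a b
    · rw [indicator_of_mem ht, indicator_of_mem ht, hh t ht]
    · rw [indicator_of_notMem ht, indicator_of_notMem ht]

lemma cut_apply_of_mem (a b : ℝ) (h : C(ℝ, E)) : ∀ᵐ t, t ∈ Ioo a b → cut a b h t = h t := by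
  filter_upwards [coeFn_cut a b h] with t ht hm
  rw [ht, indicator_of_mem hm]

lemma cut_apply_of_notMem (a b : ℝ) (h : C(ℝ, E)) : ∀ᵐ t, t ∉ Ioo a b → cut a b h t = 0 := by
  filter_upwards [coeFn_cut a b h] with t ht hm
  rw [ht, indicator_of_notMem hm]

/-- One Picard step: integrating a bound of order `(r - a) ^ m` raises the power by one and divides
by `m + 1`, the source of the factorial in the iteration. -/
lemma integral_norm_cut_sub_le {T a t K L : ℝ} (m : ℕ) {h h' : C(ℝ, E)} (hK : 0 ≤ K)
    (hL : 0 ≤ L) (hat : a ≤ t)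
    (hh : ∀ r ∈ Ioo 0 T, a < r → ‖h r - h' r‖ ≤ L * (K * (r - a) ^ m)) :
    ∫ r in Ioc a t, ‖(cut 0 T h - cut 0 T h') r‖ ≤ L * K * ((t - a) ^ (m + 1) / (m + 1)) := by
  have h1 : ∫ r in Ioc a t, L * K * (r - a) ^ m = L * K * ((t - a) ^ (m + 1) / (m + 1)) := by
    rw [integral_const_mul, ← intervalIntegral.integral_of_le hat,
      intervalIntegral.integral_comp_sub_right (fun x => x ^ m), integral_pow]
    simp
  rw [← h1]
  refine integral_mono_ae ((cut 0 T h - cut 0 T h').integrableOn_Ioc a t).norm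
    ((Continuous.integrableOn_Icc (by fun_prop)).mono_set Ioc_subset_Icc_self) ?_
  rw [← map_sub]
  filter_upwards [ae_restrict_of_ae (coeFn_cut 0 T (h - h')),
    ae_restrict_mem measurableSet_Ioc] with r hr hra
  rw [hr]
  by_cases hrT : r ∈ Ioo 0 T
  · rw [indicator_of_mem hrT, mul_assoc]
    exact hh r hrT hra.1
  · rw [indicator_of_notMem hrT, norm_zero]
    have : 0 ≤ r - a := sub_nonneg.2 hra.1.le
    positivity

/-- A causal Lipschitz perturbation of a constant has a unique fixed point in `L²`. -/
theorem existsUnique_eq_add_cut [CompleteSpace E] {k : L2R E → C(ℝ, E)} {a T L : ℝ} (ha : a ≤ 0)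
    (hT : 0 < T) (hL : 0 ≤ L) (c : L2R E)
    (hk : ∀ v w : L2R E, ∀ t ∈ Ioo 0 T, ‖k v t - k w t‖ ≤ L * ∫ r in Ioc a t, ‖(v - w) r‖) :
    ∃! v : L2R E, v = c + cut 0 T (k v) := by
  set Φ : L2R E → L2R E := fun v => c + cut 0 T (k v) with hΦ
  have hsub : ∀ v w, Φ v - Φ w = cut 0 T (k v) - cut 0 T (k w) := fun v w =>
    add_sub_add_left_eq_sub _ _ _
  -- The iteration runs in the norm of `L¹(a,t)`, the quantity in which causality is expressed.
  have iter : ∀ (v w : L2R E) (m : ℕ), ∀ t ∈ Ioo 0 T,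
      ∫ r in Ioc a t, ‖(Φ^[m] v - Φ^[m] w) r‖ ≤
        L ^ m * (∫ r in Ioc a T, ‖(v - w) r‖) / m.factorial * (t - a) ^ m := by
    intro v w m
    induction m with
    | zero =>
      intro t ht
      simp only [Function.iterate_zero, id_eq, pow_zero, one_mul, Nat.factorial_zero, Nat.cast_one,
        div_one, mul_one]
      exact setIntegral_mono_set ((v - w).integrableOn_Ioc a T).norm
        (Eventually.of_forall fun _ => norm_nonneg _)
        (Eventually.of_forall (Ioc_subset_Ioc_right ht.2.le))
    | succ m ih =>
      intro t ht
      rw [Function.iterate_succ_apply', Function.iterate_succ_apply', hsub]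
      refine (integral_norm_cut_sub_le m
        (K := L ^ m * (∫ r in Ioc a T, ‖(v - w) r‖) / m.factorial) (L := L)
        (by positivity) hL (ha.trans ht.1.le) ?_).trans_eq ?_
      · intro r hr _
        exact (hk _ _ r hr).trans (mul_le_mul_of_nonneg_left (ih r hr) hL)
      · rw [Nat.factorial_succ]
        push_cast
        have : (m.factorial : ℝ) ≠ 0 := by positivity
        field_simp
        ring
  -- One further application of `Φ` returns from `L¹` to `L²`, since the cut-off of a bounded
  -- function is square integrable; hence the iterate `m + 1`.
  have lip : ∀ (m : ℕ) (v w : L2R E), ‖Φ^[m + 1] v - Φ^[m + 1] w‖ ≤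
      √T * L * √(T - a) * ((L * (T - a)) ^ m / m.factorial) * ‖v - w‖ := by
    intro m v w
    have hD := (v - w).setIntegral_norm_le (a := a) (b := T) (by linarith)
    have hTa : 0 ≤ T - a := by linarith
    rw [Function.iterate_succ_apply', Function.iterate_succ_apply', hsub, ← map_sub]
    refine (norm_cut_le _ (C := L * (L ^ m * (√(T - a) * ‖v - w‖) / m.factorial * (T - a) ^ m))
      ?_ (by positivity)).trans_eq ?_
    · intro t ht
      refine (hk _ _ t ht).trans (mul_le_mul_of_nonneg_left ((iter v w m t ht).trans ?_) hL)
      have h0 : 0 ≤ t - a := by linarith [ht.1]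
      gcongr
      exact ht.2.le
    · rw [sub_zero, mul_pow]
      ring
  obtain ⟨m, hm⟩ : ∃ m : ℕ, √T * L * √(T - a) * ((L * (T - a)) ^ m / m.factorial) < 1 := by
    have := (FloorSemiring.tendsto_pow_div_factorial_atTop (L * (T - a))).const_mul
      (√T * L * √(T - a))
    rw [mul_zero] at this
    exact (this.eventually_lt_const one_pos).exists
  have hTa : 0 ≤ T - a := by linarith
  obtain ⟨K, hK⟩ : ∃ K : ℝ≥0, (K : ℝ) = √T * L * √(T - a) * ((L * (T - a)) ^ m / m.factorial) :=
    ⟨Real.toNNReal _, Real.coe_toNNReal _ (by positivity)⟩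
  have hcon : ContractingWith K Φ^[m + 1] :=
    ⟨by rw [← NNReal.coe_lt_one, hK]; exact hm, LipschitzWith.of_dist_le_mul fun v w => by
      rw [dist_eq_norm, dist_eq_norm, hK]; exact lip m v w⟩
  refine ⟨_, hcon.isFixedPt_fixedPoint_iterate.symm, fun v hv => hcon.fixedPoint_unique ?_⟩
  have hv' : Function.IsFixedPt Φ v := Eq.symm hv
  exact hv'.iterate _

end

/-! ### A priori bound, truncation and unique solvability. -/

section

/-- A Gronwall estimate with a delayed term. -/
lemma le_of_le_add_integral_delay {y : ℝ → ℝ} (hy : Continuous y) (hy0 : ∀ t, 0 ≤ y t)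
    {b T τ κ C N : ℝ} (hT : 0 < T) (hτ : τ ∈ Icc 0 b) (hκ : 0 < κ) (hN : 0 ≤ N)
    (hC : 0 ≤ C) (hpre : ∀ t ∈ Icc (-b) 0, y t ≤ N)
    (h : ∀ t ∈ Icc 0 T, y t ≤ C + κ * ∫ s in (0 : ℝ)..t, (y s + y (s - τ))) :
    ∀ t ∈ Icc 0 T, y t ≤ (2 * C + N) * Real.exp (4 * κ * T) := by
  -- The maximum `S` of the exponentially weighted function is estimated by inserting `y s ≤ S * exp
  -- (4κs)` into the integral inequality at the maximum point `r`. The weight dominates delayed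
  -- values too, being increasing.
  obtain ⟨r, hr, hmax⟩ := (isCompact_Icc (a := (0 : ℝ)) (b := T)).exists_isMaxOn
    (nonempty_Icc.2 hT.le) (f := fun s => Real.exp (-(4 * κ * s)) * y s)
    (Continuous.continuousOn (by fun_prop))
  set S := Real.exp (-(4 * κ * r)) * y r with hS
  have hS0 : 0 ≤ S := mul_nonneg (Real.exp_pos _).le (hy0 r)
  have hle : ∀ s ∈ Icc 0 T, y s ≤ S * Real.exp (4 * κ * s) := by
    intro s hs
    have h1 : Real.exp (-(4 * κ * s)) * y s ≤ S := hmax hs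
    rw [Real.exp_neg, inv_mul_le_iff₀ (Real.exp_pos _)] at h1
    linarith
  have hint : ∫ s in (0 : ℝ)..r, (y s + y (s - τ)) ≤
      ∫ s in (0 : ℝ)..r, 2 * (N + S) * Real.exp (4 * κ * s) := by
    refine intervalIntegral.integral_mono_on hr.1 (Continuous.intervalIntegrable (by fun_prop) _ _)
      (Continuous.intervalIntegrable (by fun_prop) _ _) ?_
    intro s hs
    have hsT : s ∈ Icc 0 T := ⟨hs.1, hs.2.trans hr.2⟩
    have h1 := hle s hsT
    have he : 1 ≤ Real.exp (4 * κ * s) := Real.one_le_exp (by have := hs.1; positivity)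
    have h2 : y (s - τ) ≤ (N + S) * Real.exp (4 * κ * s) := by
      rcases le_total (s - τ) 0 with h0 | h0
      · have := hpre (s - τ) ⟨by linarith [hs.1, hτ.2], h0⟩
        nlinarith
      · have h3 := hle (s - τ) ⟨h0, by linarith [hsT.2, hτ.1]⟩
        have h4 : Real.exp (4 * κ * (s - τ)) ≤ Real.exp (4 * κ * s) :=
          Real.exp_le_exp.2 (mul_le_mul_of_nonneg_left (by linarith [hτ.1]) (by positivity))
        nlinarith [Real.exp_pos (4 * κ * s)]
    nlinarith
  have hexp : ∫ s in (0 : ℝ)..r, 2 * (N + S) * Real.exp (4 * κ * s) =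
      2 * (N + S) * ((Real.exp (4 * κ * r) - 1) / (4 * κ)) := by
    rw [intervalIntegral.integral_const_mul, intervalIntegral.integral_comp_mul_left _
      (by positivity : (4 * κ) ≠ 0), integral_exp]
    simp only [mul_zero, Real.exp_zero, smul_eq_mul]
    ring
  -- The rate `4κ` is chosen so that the integral term contributes only `(N + S) / 2`; half of `S`
  -- is absorbed on the left.
  have hSle : S ≤ 2 * C + N := by
    have h1 := h r hr
    have h2 : κ * (2 * (N + S) * ((Real.exp (4 * κ * r) - 1) / (4 * κ))) =
        (N + S) / 2 * (Real.exp (4 * κ * r) - 1) := by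
      field_simp
      ring
    have h3 : y r = S * Real.exp (4 * κ * r) := by
      rw [hS, Real.exp_neg]
      field_simp
    have h4 : y r ≤ C + (N + S) / 2 * (Real.exp (4 * κ * r) - 1) := by
      rw [← h2, ← hexp]
      exact h1.trans (add_le_add_right (mul_le_mul_of_nonneg_left hint hκ.le) _)
    have he : 1 ≤ Real.exp (4 * κ * r) := Real.one_le_exp (by have := hr.1; positivity)
    rw [h3] at h4
    have h5 : S * Real.exp (4 * κ * r) ≤ (C + (N + S) / 2) * Real.exp (4 * κ * r) := by
      nlinarith
    have := le_of_mul_le_mul_right h5 (Real.exp_pos _)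
    linarith
  intro t ht
  refine (hle t ht).trans ?_
  have : Real.exp (4 * κ * t) ≤ Real.exp (4 * κ * T) :=
    Real.exp_le_exp.2 (mul_le_mul_of_nonneg_left ht.2 (by positivity))
  exact mul_le_mul hSle this (Real.exp_pos _).le (by positivity)

section NormedSpace

variable {E F : Type*} [NormedAddCommGroup E] [NormedSpace ℝ E]
  [NormedAddCommGroup F] [NormedSpace ℝ F]

/-- The absolutely continuous function with value `p` at `0` and derivative `v`. -/
noncomputable def state (p : E) (v : L2R E) : C(ℝ, E) := ContinuousMap.const ℝ p + prim v

@[simp] lemma state_apply (p : E) (v : L2R E) (t : ℝ) : state p v t = p + prim v t := rfl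

/-- The right-hand side `A x(t-τ) - f(x(t))` of the delay equation, for `x(0) = p` and `ẋ = v`. -/
noncomputable def delayRhs (A : E →L[ℝ] E) (f : C(E, E)) (p : E) (τ : ℝ) (v : L2R E) : C(ℝ, E) :=
  (A : C(E, E)).comp (delay τ (state p v)) - f.comp (state p v)

@[simp] lemma delayRhs_apply (A : E →L[ℝ] E) (f : C(E, E)) (p : E) (τ : ℝ) (v : L2R E) (t : ℝ) :
    delayRhs A f p τ v t = A (p + prim v (t - τ)) - f (p + prim v t) := rfl

lemma norm_prim_sub_prim_le_integral (v w : L2R E) {a s t : ℝ} (ha : a ≤ 0) (ht : 0 ≤ t)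
    (hs : s ∈ Icc a t) : ‖prim v s - prim w s‖ ≤ ∫ r in Ioc a t, ‖(v - w) r‖ := by
  have := norm_prim_le_integral (v - w) ha ht hs
  rwa [map_sub] at this

theorem existsUnique_of_lipschitzWith [CompleteSpace E] {b T τ : ℝ} (hb : 0 ≤ b) (hT : 0 < T)
    (hτ : τ ∈ Icc 0 b) (A : E →L[ℝ] E) (f : C(E, E)) {K : ℝ≥0} (hf : LipschitzWith K f) (p : E)
    (c : L2R E) : ∃! v : L2R E, v = c + cut 0 T (delayRhs A f p τ v) := by
  refine existsUnique_eq_add_cut (a := -b) (L := ‖A‖ + K) (by linarith) hT (by positivity) c ?_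
  intro v w t ht
  have h1 := norm_prim_sub_prim_le_integral v w (a := -b) (s := t - τ) (t := t) (by linarith)
    ht.1.le ⟨by linarith [hτ.2, ht.1], by linarith [hτ.1]⟩
  have h2 := norm_prim_sub_prim_le_integral v w (a := -b) (s := t) (t := t) (by linarith)
    ht.1.le ⟨by linarith [ht.1], le_rfl⟩
  have h3 : delayRhs A f p τ v t - delayRhs A f p τ w t =
      A (prim v (t - τ) - prim w (t - τ)) - (f (p + prim v t) - f (p + prim w t)) := by
    simp only [delayRhs_apply, map_add, map_sub]
    abel
  have h4 : ‖f (p + prim v t) - f (p + prim w t)‖ ≤ K * ‖prim v t - prim w t‖ := by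
    refine (hf.norm_sub_le _ _).trans_eq ?_
    rw [add_sub_add_left_eq_sub]
  rw [h3, add_mul]
  refine (norm_sub_le _ _).trans (add_le_add ((A.le_opNorm _).trans ?_) (h4.trans ?_))
  · exact mul_le_mul_of_nonneg_left h1 (norm_nonneg _)
  · exact mul_le_mul_of_nonneg_left h2 K.2

end NormedSpace

section Inner

variable {E : Type*} [NormedAddCommGroup E] [InnerProductSpace ℝ E]

/-- Along the segment from `0` to `x`, the function `s ↦ ⟨f(sx) + λsx, x⟩` has nonnegative
derivative; compare `s = 0` and `s = 1`. -/
lemma inner_sub_ge_of_fderiv {f : E → E} (hf : ContDiff ℝ 1 f) {lam : ℝ}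
    (hDf : ∀ x v : E, 0 ≤ inner ℝ (fderiv ℝ f x v + lam • v) v) (x : E) :
    -(lam * ‖x‖ ^ 2) ≤ inner ℝ (f x - f 0) x := by
  have hd : ∀ s : ℝ, HasDerivAt (fun s : ℝ => inner ℝ (f (s • x) + (lam * s) • x) x)
      (inner ℝ (fderiv ℝ f (s • x) x + lam • x) x) s := by
    intro s
    have h1 : HasDerivAt (fun s : ℝ => s • x) x s := by
      simpa using (hasDerivAt_id s).smul_const x
    have h2 : HasDerivAt (fun s : ℝ => f (s • x)) (fderiv ℝ f (s • x) x) s :=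
      ((hf.differentiable one_ne_zero) (s • x)).hasFDerivAt.comp_hasDerivAt s h1
    have h3 : HasDerivAt (fun s : ℝ => (lam * s) • x) (lam • x) s := by
      simpa using ((hasDerivAt_id s).const_mul lam).smul_const x
    simpa using (h2.add h3).inner ℝ (hasDerivAt_const s x)
  have hm : Monotone (fun s : ℝ => inner ℝ (f (s • x) + (lam * s) • x) x) :=
    monotone_of_deriv_nonneg (fun s => (hd s).differentiableAt)
      (fun s => by rw [(hd s).deriv]; exact hDf _ _)
  have := hm zero_le_one
  simp only [zero_smul, mul_zero, add_zero, one_smul, mul_one, inner_add_left, inner_smul_left,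
    real_inner_self_eq_norm_sq] at this
  rw [inner_sub_left]
  simp at this
  linarith

/-- The truncation is `f 0 + χ • (f - f 0)` with a bump function `χ`. Monotonicity of `f + λ` need
not survive this, but the one-sided estimate relative to `0` does, because `0 ≤ χ ≤ 1`; it is all
that the a priori bound uses. -/
lemma exists_lipschitz_truncation [FiniteDimensional ℝ E] {f : E → E} (hf : ContDiff ℝ 1 f)
    {lam : ℝ} (hlam : 0 ≤ lam) (hmono : ∀ x, -(lam * ‖x‖ ^ 2) ≤ inner ℝ (f x - f 0) x) {R : ℝ}
    (hR : 0 < R) :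
    ∃ (g : C(E, E)) (K : ℝ≥0), LipschitzWith K g ∧ (∀ x, ‖x‖ ≤ R → g x = f x) ∧
      ∀ x, -(lam * ‖x‖ ^ 2) ≤ inner ℝ (g x - f 0) x := by
  let χ : ContDiffBump (0 : E) := ⟨R, R + 1, hR, by linarith⟩
  have h1 : ContDiff ℝ 1 fun x => χ x • (f x - f 0) := χ.contDiff.smul (hf.sub contDiff_const)
  have h2 : HasCompactSupport fun x => χ x • (f x - f 0) := χ.hasCompactSupport.smul_right
  obtain ⟨K, hK⟩ := h1.lipschitzWith_of_hasCompactSupport h2 one_ne_zero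
  refine ⟨⟨fun x => f 0 + χ x • (f x - f 0), by have := h1.continuous; fun_prop⟩, K, ?_, ?_, ?_⟩
  · refine LipschitzWith.of_dist_le_mul fun x y => ?_
    simpa using hK.dist_le_mul x y
  · intro x hx
    have : χ x = 1 := χ.one_of_mem_closedBall (by simpa using hx)
    simp [this]
  · intro x
    simp only [ContinuousMap.coe_mk, add_sub_cancel_left, inner_smul_left]
    have h3 : 0 ≤ χ x := χ.nonneg
    have h4 : χ x ≤ 1 := χ.le_one
    have h5 : 0 ≤ lam * ‖x‖ ^ 2 := by positivity
    simp only [conj_trivial]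
    nlinarith [hmono x]

lemma intervalIntegrable_inner_state (p : E) (v : L2R E) (a b : ℝ) :
    IntervalIntegrable (fun s => inner ℝ (state p v s) (v s)) volume a b := by
  obtain ⟨C, hC⟩ := (isCompact_uIcc (a := a) (b := b)).exists_bound_of_continuousOn
    (state p v).continuous.continuousOn
  refine ((v.intervalIntegrable a b).norm.const_mul C).mono_fun ?_ ?_
  · exact ((state p v).continuous.aestronglyMeasurable.inner
      (Lp.aestronglyMeasurable v)).restrict
  · filter_upwards [ae_restrict_mem measurableSet_uIoc] with s hs
    have hCs := hC s (uIoc_subset_uIcc hs)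
    have hC0 : 0 ≤ C := (norm_nonneg _).trans hCs
    rw [Real.norm_of_nonneg (by positivity : 0 ≤ C * ‖v s‖)]
    exact (norm_inner_le_norm _ _).trans (mul_le_mul_of_nonneg_right hCs (norm_nonneg _))

/-- The integrand of the energy estimate, by Young's inequality. The nonlinearity enters only
through the one-sided bound, so no growth condition is needed. -/
lemma two_mul_inner_delay_le (A : E →L[ℝ] E) {lam : ℝ} {f₀ x y c u : E}
    (hlam : 0 ≤ lam) (hu : -(lam * ‖x‖ ^ 2) ≤ inner ℝ (u - f₀) x) :
    2 * inner ℝ x (c + (A y - u)) ≤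
      ‖c‖ ^ 2 + ‖f₀‖ ^ 2 + (2 + 2 * lam + ‖A‖) * (‖x‖ ^ 2 + ‖y‖ ^ 2) := by
  have h1 : inner ℝ x (c + (A y - u)) =
      inner ℝ x c + inner ℝ x (A y) - inner ℝ (u - f₀) x - inner ℝ x f₀ := by
    rw [inner_add_right, inner_sub_right, inner_sub_left, real_inner_comm x u,
      real_inner_comm x f₀]
    ring
  have h2 : inner ℝ x c ≤ ‖x‖ * ‖c‖ := real_inner_le_norm _ _
  have h3 : inner ℝ x (A y) ≤ ‖x‖ * (‖A‖ * ‖y‖) := (real_inner_le_norm _ _).trans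
    (mul_le_mul_of_nonneg_left (A.le_opNorm y) (norm_nonneg _))
  have h4 : -inner ℝ x f₀ ≤ ‖x‖ * ‖f₀‖ := (neg_le_abs _).trans (abs_real_inner_le_norm _ _)
  have h5 : ‖A‖ * (2 * (‖x‖ * ‖y‖)) ≤ ‖A‖ * (‖x‖ ^ 2 + ‖y‖ ^ 2) :=
    mul_le_mul_of_nonneg_left (by nlinarith [sq_nonneg (‖x‖ - ‖y‖)]) (norm_nonneg _)
  have h6 : 0 ≤ lam * ‖y‖ ^ 2 := by positivity
  rw [h1]
  nlinarith [sq_nonneg (‖x‖ - ‖c‖), sq_nonneg (‖x‖ - ‖f₀‖), sq_nonneg ‖y‖]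

/-- The energy identity: the squared norm of the state is absolutely continuous, as the state is
bounded on the compact interval. -/
lemma norm_sq_state_eq [CompleteSpace E] (p : E) (v : L2R E) (t : ℝ) :
    ‖state p v t‖ ^ 2 = ‖p‖ ^ 2 + ∫ s in (0 : ℝ)..t, 2 * inner ℝ (state p v s) (v s) := by
  obtain ⟨C, hC⟩ := (isCompact_uIcc (a := (0 : ℝ)) (b := t)).exists_bound_of_continuousOn
    (state p v).continuous.continuousOn
  have hac : AbsolutelyContinuousOnInterval (fun s => ‖state p v s‖ ^ 2) 0 t := by
    refine absolutelyContinuousOnInterval_of_dist_le (C := 2 * C)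
      (absolutelyContinuousOnInterval_prim v 0 t) ?_
    intro r hr s hs
    rw [Real.dist_eq, sq_sub_sq, abs_mul, dist_eq_norm]
    have h1 := hC r hr
    have h2 := hC s hs
    have h3 : |‖state p v r‖ - ‖state p v s‖| ≤ ‖prim v r - prim v s‖ := by
      refine (abs_norm_sub_norm_le _ _).trans_eq ?_
      simp
    have h4 : |‖state p v r‖ + ‖state p v s‖| ≤ 2 * C := by
      rw [abs_of_nonneg (by positivity)]
      linarith
    exact mul_le_mul h4 h3 (abs_nonneg _) ((abs_nonneg _).trans h4)
  have hi : IntervalIntegrable (fun s => 2 * inner ℝ (state p v s) (v s)) volume 0 t :=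
    (intervalIntegrable_inner_state p v 0 t).const_mul 2
  have := integral_eq_sub_of_absolutelyContinuousOnInterval hac hi (by
    filter_upwards [ae_hasDerivAt_prim v] with s hs _
    exact (hs.const_add p).norm_sq)
  rw [this]
  simp

/-- The a priori bound for solutions of the delay equation. It depends on the nonlinearity only
through the constants in the one-sided estimate. -/
lemma exists_norm_state_le [CompleteSpace E] {b T : ℝ} (hb : 0 ≤ b) (hT : 0 < T)
    (A : E →L[ℝ] E) {lam : ℝ} (hlam : 0 ≤ lam) (f₀ p : E) (c : L2R E) :
    ∃ M > 0, ∀ τ ∈ Icc 0 b, ∀ g : C(E, E),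
      (∀ x, -(lam * ‖x‖ ^ 2) ≤ inner ℝ (g x - f₀) x) → ∀ v : L2R E,
      v = c + cut 0 T (delayRhs A g p τ v) → ∀ t ∈ Icc 0 T, ‖state p v t‖ ≤ M := by
  have hc2 : Integrable (fun s => ‖c s‖ ^ 2) := (Lp.memLp c).integrable_norm_pow (by norm_num)
  set κ : ℝ := 2 + 2 * lam + ‖A‖ with hκ
  set C : ℝ := ‖p‖ ^ 2 + (∫ s, ‖c s‖ ^ 2) + T * ‖f₀‖ ^ 2 with hC
  set N : ℝ := (‖p‖ + √b * ‖c‖) ^ 2 with hN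
  have hc0 : 0 ≤ ∫ s, ‖c s‖ ^ 2 := integral_nonneg fun s => by positivity
  have hκ0 : 0 < κ := by positivity
  have hC0 : 0 ≤ C := by positivity
  have hN0 : 0 ≤ N := by positivity
  -- The added `1` keeps the bound positive even for zero data, since it later serves as the radius
  -- of a truncation.
  refine ⟨√((2 * C + N) * Real.exp (4 * κ * T)) + 1, by positivity, ?_⟩
  intro τ hτ g hg v hv
  have hv_neg : ∀ᵐ s, s ∈ Ioo (-b) 0 → v s = c s := by
    filter_upwards [Lp.coeFn_add c (cut 0 T (delayRhs A g p τ v)),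
      cut_apply_of_notMem 0 T (delayRhs A g p τ v)] with s h1 h2 hs
    rw [hv, h1, Pi.add_apply, h2 (fun h => lt_asymm h.1 hs.2), add_zero]
  have hv_pos : ∀ᵐ s, s ∈ Ioo 0 T →
      v s = c s + (A (state p v (s - τ)) - g (state p v s)) := by
    have h3 := Lp.coeFn_add c (cut 0 T (delayRhs A g p τ v))
    rw [← hv] at h3
    filter_upwards [h3, cut_apply_of_mem 0 T (delayRhs A g p τ v)] with s h1 h2 hs
    rw [h1, Pi.add_apply, h2 hs]
    rfl
  have hcont : Continuous fun t => ‖state p v t‖ ^ 2 := by fun_prop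
  have hcd : Continuous fun s => ‖state p v s‖ ^ 2 + ‖state p v (s - τ)‖ ^ 2 := by fun_prop
  have key := le_of_le_add_integral_delay (y := fun t => ‖state p v t‖ ^ 2) hcont
    (fun t => by positivity) hT hτ hκ0 hN0 hC0 ?_ ?_
  · intro t ht
    have := Real.le_sqrt_of_sq_le (key t ht)
    linarith
  · intro t ht
    have h1 : prim v t = prim c t := prim_congr hv_neg (by linarith) le_rfl ht
    have h2 : ‖prim c t‖ ≤ √b * ‖c‖ := by
      refine (norm_prim_le c t).trans (mul_le_mul_of_nonneg_right ?_ (norm_nonneg _))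
      refine Real.sqrt_le_sqrt ?_
      rw [abs_of_nonpos ht.2]
      linarith [ht.1]
    simp only [state_apply, h1]
    refine pow_le_pow_left₀ (norm_nonneg _) ((norm_add_le _ _).trans ?_) 2
    linarith
  · intro t ht
    have hci : IntervalIntegrable (fun s => ‖c s‖ ^ 2) volume 0 t := hc2.intervalIntegrable
    have hT' : ∀ᵐ s : ℝ, s ≠ T := by simp [ae_iff, measure_singleton]
    have hle : ∫ s in (0 : ℝ)..t, 2 * inner ℝ (state p v s) (v s) ≤
        ∫ s in (0 : ℝ)..t, ((‖c s‖ ^ 2 + ‖f₀‖ ^ 2) +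
          κ * (‖state p v s‖ ^ 2 + ‖state p v (s - τ)‖ ^ 2)) := by
      refine intervalIntegral.integral_mono_ae_restrict ht.1
        ((intervalIntegrable_inner_state p v 0 t).const_mul 2)
        ((hci.add intervalIntegrable_const).add ((hcd.intervalIntegrable _ _).const_mul κ)) ?_
      have h0' : ∀ᵐ s : ℝ, s ≠ 0 := by simp [ae_iff, measure_singleton]
      filter_upwards [ae_restrict_mem measurableSet_Icc, ae_restrict_of_ae hv_pos,
        ae_restrict_of_ae h0', ae_restrict_of_ae hT'] with s hs h1 h2 h3
      rw [h1 ⟨lt_of_le_of_ne hs.1 h2.symm, lt_of_le_of_ne (hs.2.trans ht.2) h3⟩]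
      exact two_mul_inner_delay_le A hlam (hg _)
    have hsplit : ∫ s in (0 : ℝ)..t, ((‖c s‖ ^ 2 + ‖f₀‖ ^ 2) +
          κ * (‖state p v s‖ ^ 2 + ‖state p v (s - τ)‖ ^ 2)) =
        (∫ s in (0 : ℝ)..t, ‖c s‖ ^ 2) + t * ‖f₀‖ ^ 2 +
          κ * ∫ s in (0 : ℝ)..t, (‖state p v s‖ ^ 2 + ‖state p v (s - τ)‖ ^ 2) := by
      rw [intervalIntegral.integral_add (hci.add intervalIntegrable_const)
        ((hcd.intervalIntegrable _ _).const_mul κ),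
        intervalIntegral.integral_add hci intervalIntegrable_const,
        intervalIntegral.integral_const, intervalIntegral.integral_const_mul]
      simp
    have hcle : ∫ s in (0 : ℝ)..t, ‖c s‖ ^ 2 ≤ ∫ s, ‖c s‖ ^ 2 := by
      rw [intervalIntegral.integral_of_le ht.1]
      exact setIntegral_le_integral hc2 (Eventually.of_forall fun s => by positivity)
    have hf₀ : t * ‖f₀‖ ^ 2 ≤ T * ‖f₀‖ ^ 2 := mul_le_mul_of_nonneg_right ht.2 (by positivity)
    rw [norm_sq_state_eq]
    rw [hsplit] at hle
    linarith

/-- Unique solvability of the delay equation, as an equation for the derivative. -/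
theorem existsUnique_delay [FiniteDimensional ℝ E] {b T τ : ℝ} (hb : 0 ≤ b) (hT : 0 < T)
    (hτ : τ ∈ Icc 0 b) (A : E →L[ℝ] E) (f : C(E, E)) (hf : ContDiff ℝ 1 f) {lam : ℝ}
    (hlam : 0 ≤ lam) (hDf : ∀ x v : E, 0 ≤ inner ℝ (fderiv ℝ f x v + lam • v) v) (p : E)
    (c : L2R E) : ∃! v : L2R E, v = c + cut 0 T (delayRhs A f p τ v) := by
  have hmono := inner_sub_ge_of_fderiv hf hDf
  obtain ⟨M, hM, hbound⟩ := exists_norm_state_le hb hT A hlam (f 0) p c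
  obtain ⟨g, K, hgK, hgf, hgm⟩ := exists_lipschitz_truncation hf hlam hmono hM
  have hcongr : ∀ v : L2R E, (∀ t ∈ Icc 0 T, ‖state p v t‖ ≤ M) →
      cut 0 T (delayRhs A g p τ v) = cut 0 T (delayRhs A f p τ v) := fun v hv =>
    cut_congr fun t ht => by
      rw [delayRhs_apply, delayRhs_apply, hgf]
      exact hv t (Ioo_subset_Icc_self ht)
  obtain ⟨v, hv, huniq⟩ := existsUnique_of_lipschitzWith hb hT hτ A g hgK p c
  refine ⟨v, ?_, fun w hw => huniq w ?_⟩
  · beta_reduce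
    rw [← hcongr v (hbound τ hτ g hgm v hv)]
    exact hv
  -- The nonlinearity `f` itself satisfies the one-sided estimate, so any solution for `f` stays in
  -- the ball where `g = f` and also solves the truncated equation.
  · beta_reduce at hw ⊢
    rw [hcongr w (hbound τ hτ f hmono w hw)]
    exact hw

end Inner

end

/-! ### Strict differentiability of the delay and superposition operators in `L²`. -/

section

variable {E F : Type*} [NormedAddCommGroup E] [NormedSpace ℝ E]
  [NormedAddCommGroup F] [NormedSpace ℝ F]

section Translation

lemma L2R.lintegral_enorm_sq (v : L2R E) : ∫⁻ t, ‖v t‖ₑ ^ 2 = ‖v‖ₑ ^ 2 := by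
  rw [Lp.enorm_def, eLpNorm_eq_lintegral_rpow_enorm_toReal (by norm_num) (by norm_num),
    ← ENNReal.rpow_natCast, ← ENNReal.rpow_mul]
  norm_num

lemma enorm_setIntegral_sq_le {h : ℝ → E} {S : Set ℝ}
    (hm : AEStronglyMeasurable h (volume.restrict S)) :
    ‖∫ s in S, h s‖ₑ ^ 2 ≤ volume S * ∫⁻ s in S, ‖h s‖ₑ ^ 2 := by
  have h1 : ‖∫ s in S, h s‖ₑ ≤ eLpNorm h 2 (volume.restrict S) * volume S ^ (1 / 2 : ℝ) := by
    refine (enorm_integral_le_lintegral_enorm h).trans ?_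
    rw [← eLpNorm_one_eq_lintegral_enorm]
    refine (eLpNorm_le_eLpNorm_mul_rpow_measure_univ (q := 2) (by norm_num) hm).trans_eq ?_
    rw [Measure.restrict_apply_univ]
    norm_num
  refine (pow_le_pow_left₀ zero_le h1 2).trans_eq ?_
  rw [mul_pow, mul_comm, eLpNorm_eq_lintegral_rpow_enorm_toReal (by norm_num) (by norm_num),
    ← ENNReal.rpow_natCast, ← ENNReal.rpow_mul, ← ENNReal.rpow_natCast, ← ENNReal.rpow_mul]
  norm_num

/-- The restriction of an `L²` function to `(a,b)`, extended by zero. -/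
noncomputable def trunc (a b : ℝ) (v : L2R E) : L2R E :=
  ((Lp.memLp v).indicator (measurableSet_Ioo (a := a) (b := b))).toLp _

lemma coeFn_trunc (a b : ℝ) (v : L2R E) : trunc a b v =ᵐ[volume] (Ioo a b).indicator v :=
  MemLp.coeFn_toLp _

/-- The error of linearization in the delay, written as an average of differences of translates, to
which continuity of translation applies. -/
lemma prim_delay_sub_eq_integral (v u : L2R E) (τ τ' τ₀ t : ℝ) [CompleteSpace E] :
    prim v (t - τ) - prim v (t - τ') + (τ - τ') • u (t - τ₀) =
      ∫ s in τ'..τ, (u (t - τ₀) - v (t - s)) := by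
  have hi : IntervalIntegrable (fun s => v (t - s)) volume τ' τ := by
    simpa using (v.intervalIntegrable (t - τ') (t - τ)).comp_sub_left t
  rw [intervalIntegral.integral_sub intervalIntegrable_const hi, intervalIntegral.integral_const,
    intervalIntegral.integral_comp_sub_left (fun s => v s), prim_sub_prim,
    intervalIntegral.integral_symm]
  abel

/-- The derivative of `τ ↦ x(·-τ)` in `L²`, quantitatively. -/
lemma norm_cut_delay_sub_le [CompleteSpace E] (a b : ℝ) (v u : L2R E) (τ τ' τ₀ : ℝ) {ε : ℝ}
    (hε : 0 ≤ ε) (h : ∀ s ∈ uIcc τ' τ, ‖translate τ₀ u - translate s v‖ ≤ ε) :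
    ‖cut a b (delay τ (prim v)) - cut a b (delay τ' (prim v)) +
      (τ - τ') • trunc a b (translate τ₀ u)‖ ≤ ε * |τ - τ'| := by
  set d := cut a b (delay τ (prim v)) - cut a b (delay τ' (prim v)) +
      (τ - τ') • trunc a b (translate τ₀ u) with hd
  have hmeas : StronglyMeasurable fun q : ℝ × ℝ => u (q.1 - τ₀) - v (q.1 - q.2) := by
    refine StronglyMeasurable.sub ?_ ?_
    · exact (Lp.stronglyMeasurable u).comp_measurable (by fun_prop)
    · exact (Lp.stronglyMeasurable v).comp_measurable (by fun_prop)
  -- Cauchy–Schwarz in the delay variable `s` for fixed `t`. Tonelli then exchanges `s` and `t`,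
  -- leaving the squared `L²` distance of translates, at most `ε ^ 2` for each `s`.
  have h1 : ∀ᵐ t, ‖d t‖ₑ ^ 2 ≤
      ENNReal.ofReal |τ - τ'| * ∫⁻ s in uIoc τ' τ, ‖u (t - τ₀) - v (t - s)‖ₑ ^ 2 := by
    filter_upwards [Lp.coeFn_add (cut a b (delay τ (prim v)) - cut a b (delay τ' (prim v)))
        ((τ - τ') • trunc a b (translate τ₀ u)),
      Lp.coeFn_sub (cut a b (delay τ (prim v))) (cut a b (delay τ' (prim v))),
      Lp.coeFn_smul (τ - τ') (trunc a b (translate τ₀ u)), coeFn_trunc a b (translate τ₀ u),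
      coeFn_translate τ₀ u, coeFn_cut a b (delay τ (prim v)), coeFn_cut a b (delay τ' (prim v))]
      with t e1 e2 e3 e4 e5 e6 e7
    rw [hd, e1, Pi.add_apply, e2, Pi.sub_apply, e3, Pi.smul_apply, e4, e6, e7]
    by_cases ht : t ∈ Ioo a b
    · rw [indicator_of_mem ht, indicator_of_mem ht, indicator_of_mem ht, e5, delay_apply,
        delay_apply, prim_delay_sub_eq_integral, ← Real.volume_uIoc]
      refine le_trans (le_of_eq ?_) (enorm_setIntegral_sq_le (S := uIoc τ' τ)
        (hmeas.comp_measurable (by fun_prop : Measurable fun s : ℝ => (t, s))).aestronglyMeasurable)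
      rw [← ofReal_norm, ← ofReal_norm, intervalIntegral.norm_intervalIntegral_eq]
    · simp [indicator_of_notMem ht]
  have h2 : ∫⁻ t, ‖d t‖ₑ ^ 2 ≤ ENNReal.ofReal ((ε * |τ - τ'|) ^ 2) := by
    refine (lintegral_mono_ae h1).trans ?_
    rw [lintegral_const_mul' _ _ ENNReal.ofReal_ne_top,
      lintegral_lintegral_swap (hmeas.enorm.pow_const 2).aemeasurable]
    have h3 : ∀ s ∈ uIoc τ' τ, ∫⁻ t, ‖u (t - τ₀) - v (t - s)‖ₑ ^ 2 ≤ ENNReal.ofReal (ε ^ 2) := by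
      intro s hs
      have h4 := (translate τ₀ u - translate s v).lintegral_enorm_sq
      have h5 : ∫⁻ t, ‖u (t - τ₀) - v (t - s)‖ₑ ^ 2 = ‖translate τ₀ u - translate s v‖ₑ ^ 2 := by
        rw [← h4]
        refine lintegral_congr_ae ?_
        filter_upwards [Lp.coeFn_sub (translate τ₀ u) (translate s v), coeFn_translate τ₀ u,
          coeFn_translate s v] with t e1 e2 e3
        rw [e1, Pi.sub_apply, e2, e3]
      rw [h5, ENNReal.ofReal_pow hε, ← ofReal_norm]
      gcongr
      exact h s (uIoc_subset_uIcc hs)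
    refine (mul_le_mul_right (setLIntegral_mono measurable_const h3) _).trans_eq ?_
    rw [setLIntegral_const, Real.volume_uIoc, mul_pow, ENNReal.ofReal_mul (by positivity),
      sq |τ - τ'|, ENNReal.ofReal_mul (abs_nonneg _)]
    ring
  rw [L2R.lintegral_enorm_sq, ← ofReal_norm, ← ENNReal.ofReal_pow (norm_nonneg _),
    ENNReal.ofReal_le_ofReal_iff (by positivity)] at h2
  exact (sq_le_sq₀ (norm_nonneg _) (by positivity)).1 h2

/-- The map `v ↦ 1_(0,T) (∫₀ v)(·-τ)` on `L²`. -/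
noncomputable def cutPrim (T τ : ℝ) : L2R E →L[ℝ] L2R E :=
  LinearMap.mkContinuous (cut 0 T ∘ₗ delay τ ∘ₗ prim) (√T * √(T + |τ|)) fun v => by
    simp only [LinearMap.comp_apply]
    refine (norm_cut_le _ (C := √(T + |τ|) * ‖v‖) (fun t ht => ?_) (by positivity)).trans_eq ?_
    · refine (norm_prim_le v (t - τ)).trans ?_
      gcongr
      refine (abs_sub _ _).trans ?_
      rw [abs_of_pos ht.1]
      linarith [ht.2]
    · rw [sub_zero, mul_assoc]

lemma cutPrim_apply (T τ : ℝ) (v : L2R E) : cutPrim T τ v = cut 0 T (delay τ (prim v)) := rfl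

/-- Hölder continuity of order `1/2` in the delay, uniformly on bounded sets of `v`. It disposes of
the mixed term in the joint derivative. -/
lemma norm_cutPrim_sub_le (T τ τ' : ℝ) (v : L2R E) :
    ‖cutPrim T τ v - cutPrim T τ' v‖ ≤ √T * √|τ - τ'| * ‖v‖ := by
  rw [cutPrim_apply, cutPrim_apply, ← map_sub]
  refine (norm_cut_le _ (C := √|τ - τ'| * ‖v‖) (fun t ht => ?_) (by positivity)).trans_eq ?_
  · refine (norm_prim_sub_le v (t - τ') (t - τ)).trans_eq ?_
    rw [show t - τ - (t - τ') = -(τ - τ') by ring, abs_neg]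
  · rw [sub_zero, mul_assoc]

/-- Joint strict differentiability of `(τ, v) ↦ 1_(0,T) (∫₀ v)(·-τ)` in `L²`. -/
theorem hasStrictFDerivAt_cutPrim [CompleteSpace E] {T : ℝ} (τ₀ : ℝ) (v₀ : L2R E) :
    HasStrictFDerivAt (fun q : ℝ × L2R E => cutPrim T q.1 q.2)
      (cutPrim T τ₀ ∘L ContinuousLinearMap.snd ℝ ℝ (L2R E) -
        (ContinuousLinearMap.fst ℝ ℝ (L2R E)).smulRight (trunc 0 T (translate τ₀ v₀)))
      (τ₀, v₀) := by
  rw [hasStrictFDerivAt_iff_isLittleO, Asymptotics.isLittleO_iff]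
  intro ε hε
  have hcont : ContinuousAt (fun q : ℝ × L2R E => translate q.1 q.2) (τ₀, v₀) :=
    continuous_translate.continuousAt
  rw [Metric.continuousAt_iff] at hcont
  obtain ⟨δ, hδ, hδ'⟩ := hcont (ε / 2) (by positivity)
  have hsq : ∀ᶠ τ in 𝓝 τ₀, √T * √|τ - τ₀| < ε / 2 := by
    have hc : Continuous fun τ => √T * √|τ - τ₀| := by fun_prop
    refine hc.continuousAt.eventually_lt_const ?_
    simpa using hε
  have hball : ∀ᶠ q : (ℝ × L2R E) × (ℝ × L2R E) in 𝓝 ((τ₀, v₀), (τ₀, v₀)),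
      q ∈ Metric.ball ((τ₀, v₀), (τ₀, v₀)) δ := Metric.ball_mem_nhds _ hδ
  have hfst : Tendsto (fun q : (ℝ × L2R E) × (ℝ × L2R E) => q.1.1) (𝓝 ((τ₀, v₀), (τ₀, v₀)))
      (𝓝 τ₀) := (continuous_fst.fst).tendsto' _ _ rfl
  filter_upwards [hfst.eventually hsq, hball] with ⟨⟨τ, v⟩, ⟨τ', v'⟩⟩ hτ hq
  simp only [Metric.mem_ball, Prod.dist_eq, max_lt_iff] at hq hτ
  obtain ⟨⟨hq1, -⟩, hq3, hq4⟩ := hq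
  have h1 := norm_cutPrim_sub_le T τ τ₀ (v - v')
  have h2 := norm_cut_delay_sub_le 0 T v' v₀ τ τ' τ₀ (ε := ε / 2) (by positivity) (by
    intro s hs
    rw [← dist_eq_norm, dist_comm]
    refine (hδ' (x := (s, v')) ?_).le
    rw [Prod.dist_eq, max_lt_iff]
    refine ⟨?_, hq4⟩
    have : s ∈ Metric.ball τ₀ δ :=
      ((convex_ball τ₀ δ).ordConnected.uIcc_subset hq3 hq1) hs
    exact this)
  -- The remainder splits into the variation of the operator acting on `v - v'`, and the variation
  -- of the delay at fixed `v'`.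
  have heq : cutPrim T τ v - cutPrim T τ' v' -
      ((cutPrim T τ₀ ∘L ContinuousLinearMap.snd ℝ ℝ (L2R E) -
        (ContinuousLinearMap.fst ℝ ℝ (L2R E)).smulRight (trunc 0 T (translate τ₀ v₀)))
          ((τ, v) - (τ', v'))) =
      (cutPrim T τ (v - v') - cutPrim T τ₀ (v - v')) +
      (cut 0 T (delay τ (prim v')) - cut 0 T (delay τ' (prim v')) +
        (τ - τ') • trunc 0 T (translate τ₀ v₀)) := by
    simp only [← cutPrim_apply, Prod.mk_sub_mk, sub_apply,
      ContinuousLinearMap.comp_apply, ContinuousLinearMap.coe_snd', ContinuousLinearMap.coe_fst',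
      ContinuousLinearMap.smulRight_apply, map_sub]
    abel
  simp only
  rw [heq]
  have h3 : ‖v - v'‖ ≤ ‖((τ, v) - (τ', v') : ℝ × L2R E)‖ := norm_snd_le ((τ, v) - (τ', v'))
  have h4 : |τ - τ'| ≤ ‖((τ, v) - (τ', v') : ℝ × L2R E)‖ := norm_fst_le ((τ, v) - (τ', v'))
  refine (norm_add_le _ _).trans ?_
  have h5 : √T * √|τ - τ₀| * ‖v - v'‖ ≤ ε / 2 * ‖((τ, v) - (τ', v') : ℝ × L2R E)‖ :=
    mul_le_mul hτ.le h3 (norm_nonneg _) (by positivity)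
  have h6 : ε / 2 * |τ - τ'| ≤ ε / 2 * ‖((τ, v) - (τ', v') : ℝ × L2R E)‖ :=
    mul_le_mul_of_nonneg_left h4 (by positivity)
  linarith

end Translation

section Nemytskii

/-- Pointwise application of a continuous family of operators. -/
noncomputable def mulC (B : C(ℝ, E →L[ℝ] F)) : C(ℝ, E) →ₗ[ℝ] C(ℝ, F) where
  toFun h := ⟨fun t => B t (h t), B.continuous.clm_apply h.continuous⟩
  map_add' h k := by ext t; simp
  map_smul' c h := by ext t; simp

@[simp] lemma mulC_apply (B : C(ℝ, E →L[ℝ] F)) (h : C(ℝ, E)) (t : ℝ) :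
    mulC B h t = B t (h t) := rfl

lemma norm_prim_le_of_mem {T t : ℝ} (ht : t ∈ Icc 0 T) (v : L2R E) :
    ‖prim v t‖ ≤ √T * ‖v‖ := by
  refine (norm_prim_le v t).trans ?_
  gcongr
  rw [abs_of_nonneg ht.1]
  exact ht.2

/-- The map `v ↦ 1_(0,T) B(·) (∫₀ v)(·)` on `L²`. -/
noncomputable def cutMulPrim (T : ℝ) (B : C(ℝ, E →L[ℝ] F)) : L2R E →L[ℝ] L2R F :=
  LinearMap.mkContinuousOfExistsBound (cut 0 T ∘ₗ mulC B ∘ₗ prim) (by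
    obtain ⟨C, hC⟩ := (isCompact_Icc (a := (0 : ℝ)) (b := T)).exists_bound_of_continuousOn
      B.continuous.continuousOn
    refine ⟨√T * (max C 0 * √T), fun v => ?_⟩
    simp only [LinearMap.comp_apply]
    refine (norm_cut_le _ (C := max C 0 * √T * ‖v‖) (fun t ht => ?_) (by positivity)).trans_eq ?_
    · have ht' := Ioo_subset_Icc_self ht
      refine ((B t).le_opNorm _).trans ?_
      rw [mul_assoc]
      exact mul_le_mul ((hC t ht').trans (le_max_left _ _)) (norm_prim_le_of_mem ht' v)
        (norm_nonneg _) (le_max_right _ _)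
    · rw [sub_zero]
      ring)

lemma cutMulPrim_apply (T : ℝ) (B : C(ℝ, E →L[ℝ] F)) (v : L2R E) :
    cutMulPrim T B v = cut 0 T (mulC B (prim v)) := rfl

/-- The derivative of `f` along a continuous curve. -/
noncomputable def fderivAlong {f : E → F} (hf : ContDiff ℝ 1 f) (x : C(ℝ, E)) :
    C(ℝ, E →L[ℝ] F) :=
  ⟨fun t => fderiv ℝ f (x t), (hf.continuous_fderiv one_ne_zero).comp x.continuous⟩

@[simp] lemma fderivAlong_apply {f : E → F} (hf : ContDiff ℝ 1 f) (x : C(ℝ, E)) (t : ℝ) :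
    fderivAlong hf x t = fderiv ℝ f (x t) := rfl

/-- Strict differentiability of the superposition operator `v ↦ 1_(0,T) f(p + ∫₀ v)` in `L²`. -/
theorem hasStrictFDerivAt_cut_comp_state {T : ℝ} (f : C(E, F)) (hf : ContDiff ℝ 1 f)
    (p : E) (v₀ : L2R E) :
    HasStrictFDerivAt (fun v : L2R E => cut 0 T (f.comp (state p v)))
      (cutMulPrim T (fderivAlong hf (state p v₀))) v₀ := by
  rw [hasStrictFDerivAt_iff_isLittleO, Asymptotics.isLittleO_iff]
  intro ε hε
  set ε' : ℝ := ε / (√T * √T + 1) with hε'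
  have hε'0 : 0 < ε' := by positivity
  have hK : IsCompact (state p v₀ '' Icc 0 T) :=
    isCompact_Icc.image (state p v₀).continuous
  -- Compactness of the orbit gives one radius `δ` for all times; the primitives of functions near
  -- `v₀` in `L²` stay uniformly within `δ` of it. The mean value inequality then applies in each
  -- ball.
  have hunif := hK.uniformContinuousAt_of_continuousAt (fderiv ℝ f)
    (fun x _ => (hf.continuous_fderiv one_ne_zero).continuousAt) (Metric.dist_mem_uniformity hε'0)
  obtain ⟨δ, hδ, hδ'⟩ := Metric.mem_uniformity_dist.1 hunif
  have hnear : ∀ᶠ v in 𝓝 v₀, √T * ‖v - v₀‖ < δ := by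
    have hc : Continuous fun v : L2R E => √T * ‖v - v₀‖ := by fun_prop
    refine hc.continuousAt.eventually_lt_const ?_
    simpa using hδ
  have h1 : Tendsto (fun q : L2R E × L2R E => q.1) (𝓝 (v₀, v₀)) (𝓝 v₀) :=
    continuous_fst.tendsto' _ _ rfl
  have h2 : Tendsto (fun q : L2R E × L2R E => q.2) (𝓝 (v₀, v₀)) (𝓝 v₀) :=
    continuous_snd.tendsto' _ _ rfl
  filter_upwards [h1.eventually hnear, h2.eventually hnear] with ⟨v, w⟩ hv hw
  simp only at hv hw ⊢
  rw [cutMulPrim_apply, ← map_sub, ← map_sub]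
  have hmem : ∀ u : L2R E, √T * ‖u - v₀‖ < δ → ∀ t ∈ Icc 0 T,
      state p u t ∈ Metric.ball (state p v₀ t) δ := by
    intro u hu t ht
    rw [Metric.mem_ball, dist_eq_norm]
    have := norm_prim_le_of_mem ht (u - v₀)
    rw [map_sub, ContinuousMap.sub_apply] at this
    rw [state_apply, state_apply, add_sub_add_left_eq_sub]
    exact this.trans_lt hu
  refine (norm_cut_le _ (C := ε' * (√T * ‖v - w‖)) (fun t ht => ?_) (by positivity)).trans ?_
  · have ht' := Ioo_subset_Icc_self ht
    have := (convex_ball (state p v₀ t) δ).norm_image_sub_le_of_norm_fderiv_le' (𝕜 := ℝ) (f := f)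
      (φ := fderiv ℝ f (state p v₀ t)) (C := ε')
      (fun x _ => (hf.differentiable one_ne_zero) x) (by
        intro x hx
        rw [← dist_eq_norm, dist_comm]
        exact (hδ' (a := state p v₀ t) (b := x) (by rw [dist_comm]; exact hx)
          ⟨t, ht', rfl⟩).le) (hmem w hw t ht') (hmem v hv t ht')
    have e : state p v t - state p w t = prim (v - w) t := by
      rw [map_sub, ContinuousMap.sub_apply, state_apply, state_apply, add_sub_add_left_eq_sub]
    rw [e] at this
    refine le_trans this (mul_le_mul_of_nonneg_left (norm_prim_le_of_mem ht' _) hε'0.le)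
  · rw [sub_zero]
    have h3 : √T * √T * ε' ≤ ε := by
      rw [hε', mul_div_assoc', div_le_iff₀ (by positivity)]
      nlinarith
    calc √T * (ε' * (√T * ‖v - w‖)) = √T * √T * ε' * ‖v - w‖ := by ring
      _ ≤ ε * ‖v - w‖ := mul_le_mul_of_nonneg_right h3 (norm_nonneg _)

end Nemytskii

end

/-! ### The implicit function theorem along the solution curve, and the linearized equation. -/

section

section Abstract

variable {V W : Type*} [NormedAddCommGroup V] [NormedSpace ℝ V]
  [NormedAddCommGroup W] [NormedSpace ℝ W]

/-- A function which agrees, near each point of an interval, with a function that is strictly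
differentiable at that point, is continuously differentiable on the interval. -/
lemma contDiffOn_one_of_hasStrictDerivAt {v : ℝ → V} {a b : ℝ} (hab : a < b)
    (h : ∀ τ ∈ Icc a b, ∃ (y : ℝ → V) (y' : V), HasStrictDerivAt y y' τ ∧
      ∀ᶠ σ in 𝓝[Icc a b] τ, v σ = y σ) :
    ContDiffOn ℝ 1 v (Icc a b) := by
  have hu : UniqueDiffOn ℝ (Icc a b) := uniqueDiffOn_Icc hab
  have hder : ∀ τ ∈ Icc a b, ∀ (y : ℝ → V) (y' : V), HasStrictDerivAt y y' τ →
      (∀ᶠ σ in 𝓝[Icc a b] τ, v σ = y σ) → HasDerivWithinAt v y' (Icc a b) τ :=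
    fun τ hτ y y' hy hv => hy.hasDerivAt.hasDerivWithinAt.congr_of_eventuallyEq hv
      (hv.self_of_nhdsWithin hτ)
  have hdiff : DifferentiableOn ℝ v (Icc a b) := fun τ hτ => by
    obtain ⟨y, y', hy, hv⟩ := h τ hτ
    exact (hder τ hτ y y' hy hv).differentiableWithinAt
  rw [show (1 : WithTop ℕ∞) = 0 + 1 by rfl, contDiffOn_succ_iff_derivWithin hu]
  refine ⟨hdiff, by simp, ?_⟩
  rw [contDiffOn_zero]
  intro τ hτ
  obtain ⟨y, y', hy, hv⟩ := h τ hτ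
  rw [ContinuousWithinAt, (hder τ hτ y y' hy hv).derivWithin (hu τ hτ), Metric.tendsto_nhds]
  intro ε hε
  have hlo := hy.hasStrictFDerivAt.isLittleO
  rw [Asymptotics.isLittleO_iff] at hlo
  obtain ⟨δ, hδ, hball⟩ := Metric.eventually_nhds_iff_ball.1 (hlo (half_pos hε))
  obtain ⟨δ', hδ', hball'⟩ := Metric.mem_nhdsWithin_iff.1 hv
  have hU : Metric.ball τ (min δ δ') ∈ 𝓝[Icc a b] τ :=
    mem_nhdsWithin_of_mem_nhds (Metric.ball_mem_nhds _ (lt_min hδ hδ'))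
  filter_upwards [hU, self_mem_nhdsWithin] with σ hσ hσS
  have hmem : ∀ s ∈ Metric.ball τ (min δ δ'), ∀ s' ∈ Metric.ball τ (min δ δ'),
      ‖y s - y s' - (s - s') • y'‖ ≤ ε / 2 * ‖s - s'‖ := by
    intro s hs s' hs'
    have := hball (s, s') (by
      rw [Metric.mem_ball, Prod.dist_eq, max_lt_iff]
      exact ⟨(Metric.mem_ball.1 hs).trans_le (min_le_left _ _),
        (Metric.mem_ball.1 hs').trans_le (min_le_left _ _)⟩)
    simpa using this
  have hyv : ∀ s ∈ Metric.ball τ (min δ δ'), s ∈ Icc a b → v s = y s := fun s hs hsS =>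
    hball' ⟨Metric.ball_subset_ball (min_le_right _ _) hs, hsS⟩
  have hslope := hasDerivWithinAt_iff_tendsto_slope.1 (hdiff σ hσS).hasDerivWithinAt
  have hne : (𝓝[Icc a b \ {σ}] σ).NeBot :=
    (accPt_principal_iff_nhdsWithin).1 (uniqueDiffWithinAt_iff_accPt.1 (hu σ hσS))
  -- Strict differentiability at `τ` alone controls all difference quotients between points near
  -- `τ`, hence their limits at nearby `σ`. This gives continuity of the derivative, at the end
  -- points too.
  have hle : ‖derivWithin v (Icc a b) σ - y'‖ ≤ ε / 2 := by
    refine le_of_tendsto (hslope.sub_const y').norm ?_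
    have hσn : Metric.ball τ (min δ δ') ∈ 𝓝[Icc a b \ {σ}] σ :=
      mem_nhdsWithin_of_mem_nhds (Metric.isOpen_ball.mem_nhds hσ)
    filter_upwards [hσn, self_mem_nhdsWithin] with s hs hsS
    have hsσ : s - σ ≠ 0 := sub_ne_zero.2 hsS.2
    have h1 := hmem s hs σ hσ
    rw [slope_def_module, hyv s hs hsS.1, hyv σ hσ hσS]
    have h2 : (s - σ)⁻¹ • (y s - y σ) - y' = (s - σ)⁻¹ • (y s - y σ - (s - σ) • y') := by
      rw [smul_sub _ (y s - y σ), smul_smul, inv_mul_cancel₀ hsσ, one_smul]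
    rw [h2, norm_smul, norm_inv, inv_mul_le_iff₀ (norm_pos_iff.2 hsσ)]
    linarith
  rw [dist_eq_norm]
  linarith

/-- The parametrized solution of an equation with unique solutions, under the assumptions of the
implicit function theorem along the solution curve. -/
theorem contDiffOn_implicit [CompleteSpace V] [CompleteSpace W] {G : ℝ × V → W} {v : ℝ → V}
    {a b : ℝ} (hab : a < b)
    (hG : ∀ τ ∈ Icc a b, ∀ w, G (τ, w) = 0 ↔ w = v τ) {D : ℝ → (ℝ × V →L[ℝ] W)}
    (hD : ∀ τ ∈ Icc a b, HasStrictFDerivAt G (D τ) (τ, v τ))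
    (hinv : ∀ τ ∈ Icc a b, (D τ ∘L .inr ℝ ℝ V).IsInvertible) :
    ContDiffOn ℝ 1 v (Icc a b) ∧ ∀ τ ∈ Icc a b, D τ (1, derivWithin v (Icc a b) τ) = 0 := by
  have hC : ContDiffOn ℝ 1 v (Icc a b) := by
    refine contDiffOn_one_of_hasStrictDerivAt hab fun τ hτ => ?_
    refine ⟨_, _, ((hD τ hτ).hasStrictFDerivAt_implicitFunctionOfProdDomain
      (hinv τ hτ)).hasStrictDerivAt, ?_⟩
    have h1 := (hD τ hτ).eventually_apply_implicitFunctionOfProdDomain (hinv τ hτ)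
    -- The implicit function lives on a full neighbourhood of `τ`, possibly beyond `[a,b]`;
    -- uniqueness identifies it with `v` only inside the interval, which suffices.
    filter_upwards [mem_nhdsWithin_of_mem_nhds h1, self_mem_nhdsWithin] with σ h2 hσ
    refine ((hG σ hσ _).1 ?_).symm
    have h3 : G (τ, v τ) = 0 := (hG τ hτ _).2 rfl
    rw [← h3]
    exact h2
  refine ⟨hC, fun τ hτ => ?_⟩
  have hv : HasDerivWithinAt v (derivWithin v (Icc a b) τ) (Icc a b) τ :=
    (hC.differentiableOn one_ne_zero τ hτ).hasDerivWithinAt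
  have h1 : HasDerivWithinAt (fun σ => G (σ, v σ)) (D τ (1, derivWithin v (Icc a b) τ))
      (Icc a b) τ :=
    (hD τ hτ).hasFDerivAt.comp_hasDerivWithinAt τ ((hasDerivWithinAt_id τ _).prodMk hv)
  have h2 : HasDerivWithinAt (fun σ => G (σ, v σ)) 0 (Icc a b) τ :=
    (hasDerivWithinAt_const τ (Icc a b) (0 : W)).congr (fun σ hσ => (hG σ hσ _).2 rfl)
      ((hG τ hτ _).2 rfl)
  exact (uniqueDiffOn_Icc hab τ hτ).eq_deriv _ h1 h2

end Abstract

section Residual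

variable {E : Type*} [NormedAddCommGroup E] [NormedSpace ℝ E]

lemma compLpL_cut (A : E →L[ℝ] E) (a b : ℝ) (h : C(ℝ, E)) :
    A.compLpL 2 volume (cut a b h) = cut a b ((A : C(E, E)).comp h) := by
  refine Lp.ext ?_
  filter_upwards [A.coeFn_compLpL (p := 2) (μ := volume) (cut a b h), coeFn_cut a b h,
    coeFn_cut a b ((A : C(E, E)).comp h)] with t h1 h2 h3
  rw [h1, h2, h3]
  by_cases ht : t ∈ Ioo a b
  · simp [indicator_of_mem ht]
  · simp [indicator_of_notMem ht]

/-- The residual of the delay equation, as a function of the delay and of the derivative. -/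
noncomputable def residual (A : E →L[ℝ] E) (f : C(E, E)) (p : E) (c : L2R E) (T : ℝ)
    (q : ℝ × L2R E) : L2R E :=
  q.2 - (c + cut 0 T (delayRhs A f p q.1 q.2))

lemma residual_eq_zero_iff (A : E →L[ℝ] E) (f : C(E, E)) (p : E) (c : L2R E) (T τ : ℝ)
    (v : L2R E) :
    residual A f p c T (τ, v) = 0 ↔ v = c + cut 0 T (delayRhs A f p τ v) := sub_eq_zero

/-- The part linear in the primitive, the superposition and the constant are separated, so that each
can be differentiated on its own. -/
lemma residual_eq (A : E →L[ℝ] E) (f : C(E, E)) (p : E) (c : L2R E) (T : ℝ) (q : ℝ × L2R E) :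
    residual A f p c T q = q.2 - A.compLpL 2 volume (cutPrim T q.1 q.2) +
      cut 0 T (f.comp (state p q.2)) -
      (c + A.compLpL 2 volume (cut 0 T (ContinuousMap.const ℝ p))) := by
  have h1 : cut 0 T ((A : C(E, E)).comp (delay q.1 (state p q.2))) =
      A.compLpL 2 volume (cut 0 T (ContinuousMap.const ℝ p)) +
        A.compLpL 2 volume (cutPrim T q.1 q.2) := by
    rw [← compLpL_cut, ← map_add, cutPrim_apply, ← map_add]
    rfl
  rw [residual, delayRhs, map_sub, h1]
  abel

/-- The linearized delay equation operator `w ↦ w - 1_(0,T) (A (∫₀ w)(·-τ) - B (∫₀ w))`. -/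
noncomputable def linResidual (A : E →L[ℝ] E) (B : C(ℝ, E →L[ℝ] E)) (T τ : ℝ) :
    L2R E →L[ℝ] L2R E :=
  ContinuousLinearMap.id ℝ (L2R E) - A.compLpL 2 volume ∘L cutPrim T τ + cutMulPrim T B

/-- The right-hand side `A w(t-τ) - B(t) w(t)` of the linearized equation, with `ẇ = v`. -/
noncomputable def linRhs (A : E →L[ℝ] E) (B : C(ℝ, E →L[ℝ] E)) (τ : ℝ) (v : L2R E) : C(ℝ, E) :=
  (A : C(E, E)).comp (delay τ (prim v)) - mulC B (prim v)

@[simp] lemma linRhs_apply (A : E →L[ℝ] E) (B : C(ℝ, E →L[ℝ] E)) (τ : ℝ) (v : L2R E) (t : ℝ) :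
    linRhs A B τ v t = A (prim v (t - τ)) - B t (prim v t) := rfl

lemma linResidual_apply (A : E →L[ℝ] E) (B : C(ℝ, E →L[ℝ] E)) (T τ : ℝ) (v : L2R E) :
    linResidual A B T τ v = v - cut 0 T (linRhs A B τ v) := by
  simp only [linResidual, linRhs, add_apply, sub_apply,
    ContinuousLinearMap.id_apply, ContinuousLinearMap.comp_apply, cutPrim_apply, cutMulPrim_apply,
    compLpL_cut, map_sub]
  abel

variable [CompleteSpace E]

lemma hasStrictFDerivAt_residual (A : E →L[ℝ] E) (f : C(E, E)) (hf : ContDiff ℝ 1 f) (p : E)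
    (c : L2R E) (T τ : ℝ) (v : L2R E) :
    HasStrictFDerivAt (residual A f p c T)
      (linResidual A (fderivAlong hf (state p v)) T τ ∘L ContinuousLinearMap.snd ℝ ℝ (L2R E) +
        (ContinuousLinearMap.fst ℝ ℝ (L2R E)).smulRight
          (A.compLpL 2 volume (trunc 0 T (translate τ v)))) (τ, v) := by
  have h1 := (A.compLpL 2 (volume : Measure ℝ)).hasStrictFDerivAt.comp (τ, v)
    (hasStrictFDerivAt_cutPrim (T := T) τ v)
  have h2 := (hasStrictFDerivAt_cut_comp_state (T := T) f hf p v).comp (τ, v)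
    (hasStrictFDerivAt_snd (𝕜 := ℝ) (p := (τ, v)))
  have h3 := ((hasStrictFDerivAt_snd (𝕜 := ℝ) (p := (τ, v))).sub h1).add h2 |>.sub_const
    (c + A.compLpL 2 volume (cut 0 T (ContinuousMap.const ℝ p)))
  have hfun : residual A f p c T = fun q => q.2 - A.compLpL 2 volume (cutPrim T q.1 q.2) +
      cut 0 T (f.comp (state p q.2)) -
      (c + A.compLpL 2 volume (cut 0 T (ContinuousMap.const ℝ p))) :=
    funext fun q => residual_eq A f p c T q
  rw [hfun]
  refine h3.congr_fderiv ?_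
  refine ContinuousLinearMap.ext fun ⟨σ, w⟩ => ?_
  simp only [linResidual, add_apply, sub_apply, ContinuousLinearMap.comp_apply,
    ContinuousLinearMap.coe_snd', ContinuousLinearMap.coe_fst', ContinuousLinearMap.id_apply,
    ContinuousLinearMap.smulRight_apply, map_sub, map_smul]
  abel

/-- The linearized right-hand side is causal and Lipschitz, with constant `‖A‖` plus the bound of
`B` on `[0,T]`. -/
lemma existsUnique_linRhs (A : E →L[ℝ] E) (B : C(ℝ, E →L[ℝ] E)) {b T τ : ℝ} (hb : 0 ≤ b)
    (hT : 0 < T) (hτ : τ ∈ Icc 0 b) (c : L2R E) :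
    ∃! v : L2R E, v = c + cut 0 T (linRhs A B τ v) := by
  obtain ⟨C, hC⟩ := (isCompact_Icc (a := (0 : ℝ)) (b := T)).exists_bound_of_continuousOn
    B.continuous.continuousOn
  have hC0 : 0 ≤ C := (norm_nonneg _).trans (hC 0 ⟨le_rfl, hT.le⟩)
  refine existsUnique_eq_add_cut (a := -b) (L := ‖A‖ + C) (by linarith) hT (by positivity) c ?_
  intro v w t ht
  have h1 := norm_prim_sub_prim_le_integral v w (a := -b) (s := t - τ) (t := t) (by linarith)
    ht.1.le ⟨by linarith [hτ.2, ht.1], by linarith [hτ.1]⟩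
  have h2 := norm_prim_sub_prim_le_integral v w (a := -b) (s := t) (t := t) (by linarith)
    ht.1.le ⟨by linarith [ht.1], le_rfl⟩
  have h3 : linRhs A B τ v t - linRhs A B τ w t =
      A (prim v (t - τ) - prim w (t - τ)) - B t (prim v t - prim w t) := by
    simp only [linRhs_apply, map_sub]
    abel
  rw [h3, add_mul]
  refine (norm_sub_le _ _).trans (add_le_add ((A.le_opNorm _).trans ?_)
    (((B t).le_opNorm _).trans ?_))
  · exact mul_le_mul_of_nonneg_left h1 (norm_nonneg _)
  · exact mul_le_mul (hC t (Ioo_subset_Icc_self ht)) h2 (norm_nonneg _) hC0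

/-- Unique solvability for each right-hand side is bijectivity; the open mapping theorem supplies
the continuous inverse. -/
lemma linResidual_isInvertible (A : E →L[ℝ] E) (B : C(ℝ, E →L[ℝ] E)) {b T τ : ℝ} (hb : 0 ≤ b)
    (hT : 0 < T) (hτ : τ ∈ Icc 0 b) : (linResidual A B T τ).IsInvertible := by
  have key : ∀ c v, linResidual A B T τ v = c ↔ v = c + cut 0 T (linRhs A B τ v) := by
    intro c v
    rw [linResidual_apply, sub_eq_iff_eq_add]
  have hbij : Function.Bijective (linResidual A B T τ) := by
    refine (Function.bijective_iff_existsUnique _).2 fun c => ?_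
    simp_rw [key]
    exact existsUnique_linRhs A B hb hT hτ c
  exact ⟨ContinuousLinearEquiv.ofBijective _ (LinearMap.ker_eq_bot.2 hbij.1)
    (LinearMap.range_eq_top.2 hbij.2), ContinuousLinearEquiv.coe_ofBijective _ _ _⟩

/-- Continuous differentiability of the solution with respect to the delay, and the linearized
equation for the derivative, in terms of the time derivatives. -/
theorem contDiffOn_delay (A : E →L[ℝ] E) (f : C(E, E)) (hf : ContDiff ℝ 1 f) (p : E)
    (c : L2R E) {b T : ℝ} (hb : 0 < b) (hT : 0 < T) {v : ℝ → L2R E}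
    (hv : ∀ τ ∈ Icc 0 b, ∀ w, w = c + cut 0 T (delayRhs A f p τ w) ↔ w = v τ) :
    ContDiffOn ℝ 1 v (Icc 0 b) ∧ ∀ τ ∈ Icc 0 b, derivWithin v (Icc 0 b) τ =
      -A.compLpL 2 volume (trunc 0 T (translate τ (v τ))) +
        cut 0 T (linRhs A (fderivAlong hf (state p (v τ))) τ (derivWithin v (Icc 0 b) τ)) := by
  have h := contDiffOn_implicit (G := residual A f p c T) (v := v) hb
    (fun τ hτ w => (residual_eq_zero_iff A f p c T τ w).trans (hv τ hτ w))
    (fun τ _ => hasStrictFDerivAt_residual A f hf p c T τ (v τ)) (fun τ hτ => by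
      have e : (linResidual A (fderivAlong hf (state p (v τ))) T τ ∘L
          ContinuousLinearMap.snd ℝ ℝ (L2R E) + (ContinuousLinearMap.fst ℝ ℝ (L2R E)).smulRight
          (A.compLpL 2 volume (trunc 0 T (translate τ (v τ))))) ∘L .inr ℝ ℝ (L2R E) =
          linResidual A (fderivAlong hf (state p (v τ))) T τ := by
        ext1 w
        simp
      rw [e]
      exact linResidual_isInvertible A _ hb.le hT hτ)
  refine ⟨h.1, fun τ hτ => ?_⟩
  have h1 := h.2 τ hτ
  simp only [add_apply, ContinuousLinearMap.comp_apply, ContinuousLinearMap.coe_snd',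
    ContinuousLinearMap.smulRight_apply, ContinuousLinearMap.coe_fst', one_smul,
    linResidual_apply] at h1
  rw [← sub_eq_zero, ← h1]
  abel

end Residual

end

/-! ### Translation between `H¹` and equations for the derivative. -/

variable {n : ℕ} {a b : ℝ}

lemma eq_add_cut_iff {E : Type*} [NormedAddCommGroup E] [NormedSpace ℝ E] {T : ℝ}
    {v c : L2R E} {h : C(ℝ, E)} :
    v = c + cut 0 T h ↔ (∀ᵐ t, t ∉ Ioo 0 T → v t = c t) ∧
      ∀ᵐ t, t ∈ Ioo 0 T → v t = c t + h t := by
  constructor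
  · intro hv
    have h1 := Lp.coeFn_add c (cut 0 T h)
    rw [← hv] at h1
    constructor
    · filter_upwards [h1, cut_apply_of_notMem 0 T h] with t e1 e2 ht
      rw [e1, Pi.add_apply, e2 ht, add_zero]
    · filter_upwards [h1, cut_apply_of_mem 0 T h] with t e1 e2 ht
      rw [e1, Pi.add_apply, e2 ht]
  · rintro ⟨h1, h2⟩
    refine Lp.ext ?_
    filter_upwards [h1, h2, Lp.coeFn_add c (cut 0 T h), coeFn_cut 0 T h] with t e1 e2 e3 e4
    rw [e3, Pi.add_apply, e4]
    by_cases ht : t ∈ Ioo 0 T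
    · rw [indicator_of_mem ht, e2 ht]
    · rw [indicator_of_notMem ht, add_zero, e1 ht]

lemma isWeakDeriv_of_ae {u v : L2 n a b} (p : Vec n) (w : L2R (Vec n))
    (hu : ∀ᵐ t, t ∈ Ioo a b → u t = p + prim w t) (hv : ∀ᵐ t, t ∈ Ioo a b → v t = w t) :
    IsWeakDeriv u v := by
  intro η hη
  have h1 : ∫ t in Ioo a b, deriv η t • u t = ∫ t in Ioo a b, deriv η t • (p + prim w t) := by
    refine setIntegral_congr_ae measurableSet_Ioo ?_
    filter_upwards [hu] with t ht hm
    rw [ht hm]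
  have h2 : ∫ t in Ioo a b, η t • v t = ∫ t in Ioo a b, η t • w t := by
    refine setIntegral_congr_ae measurableSet_Ioo ?_
    filter_upwards [hv] with t ht hm
    rw [ht hm]
  rw [h1, h2, integral_deriv_smul_prim w p hη]

/-- The restriction `L²(ℝ) → L²(a,b)`. -/
noncomputable def toIoo (n : ℕ) (a b : ℝ) : L2R (Vec n) →L[ℝ] L2 n a b :=
  LpToLpRestrictCLM ℝ (Vec n) ℝ volume 2 (Ioo a b)

lemma toIoo_apply (v : L2R (Vec n)) : ∀ᵐ t, t ∈ Ioo a b → toIoo n a b v t = v t :=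
  (ae_restrict_iff' measurableSet_Ioo).1 (LpToLpRestrictCLM_coeFn ℝ (Ioo a b) v)

lemma toIoo_cut_apply (h : C(ℝ, Vec n)) :
    ∀ᵐ t, t ∈ Ioo a b → toIoo n a b (cut a b h) t = h t := by
  filter_upwards [toIoo_apply (a := a) (b := b) (cut a b h), cut_apply_of_mem a b h]
    with t h1 h2 ht
  rw [h1 ht, h2 ht]

/-- The map `v ↦ 1_(a,b) ∫₀ v` on `L²`. -/
noncomputable def cutPrimOn (n : ℕ) (a b : ℝ) : L2R (Vec n) →L[ℝ] L2R (Vec n) :=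
  LinearMap.mkContinuous (cut a b ∘ₗ prim) (√(b - a) * √(max |a| |b|)) fun v => by
    rw [LinearMap.comp_apply, mul_assoc]
    refine norm_cut_le _ (fun t ht => ?_) (by positivity)
    refine (norm_prim_le v t).trans ?_
    gcongr
    exact abs_le_max_abs_abs ht.1.le ht.2.le

/-- The `H¹` function with value `0` at `0` and derivative `v`. -/
noncomputable def primH1 (n : ℕ) (a b : ℝ) : L2R (Vec n) →L[ℝ] H1 n a b :=
  ((WithLp.prodContinuousLinearEquiv 2 ℝ (L2 n a b) (L2 n a b)).symm.toContinuousLinearMap ∘L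
    ((toIoo n a b ∘L cutPrimOn n a b).prod (toIoo n a b))).codRestrict (H1Sub n a b) fun v =>
      isWeakDeriv_of_ae 0 v (by
        simp only [zero_add]
        exact toIoo_cut_apply (prim v)) (toIoo_apply v)

/-- The constant function in `H¹`. -/
noncomputable def constH1 (a b : ℝ) (p : Vec n) : H1 n a b :=
  ⟨WithLp.toLp 2 (toIoo n a b (cut a b (ContinuousMap.const ℝ p)), 0),
    isWeakDeriv_of_ae p 0 (by simpa using toIoo_cut_apply (ContinuousMap.const ℝ p)) (by
      filter_upwards [(ae_restrict_iff' measurableSet_Ioo).1 (Lp.coeFn_zero (Vec n) 2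
          ((volume : Measure ℝ).restrict (Ioo a b))), Lp.coeFn_zero (Vec n) 2 (volume : Measure ℝ)]
        with t h1 h2 ht
      rw [h2, ← h1 ht]
      rfl)⟩

/-- The `H¹` function with value `p` at `0` and derivative `v`. -/
noncomputable def toH1 (a b : ℝ) (p : Vec n) (v : L2R (Vec n)) : H1 n a b :=
  constH1 a b p + primH1 n a b v

lemma fn_toH1 (p : Vec n) (v : L2R (Vec n)) :
    ∀ᵐ t, t ∈ Ioo a b → (toH1 a b p v).fn t = p + prim v t := by
  have h1 : (toH1 a b p v).fn = toIoo n a b (cut a b (ContinuousMap.const ℝ p)) +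
      toIoo n a b (cut a b (prim v)) := rfl
  rw [h1, ← map_add, ← map_add]
  exact toIoo_cut_apply _

lemma dt_toH1 (p : Vec n) (v : L2R (Vec n)) :
    ∀ᵐ t, t ∈ Ioo a b → (toH1 a b p v).dt t = v t := by
  have h1 : (toH1 a b p v).dt = 0 + toIoo n a b v := rfl
  rw [h1, zero_add]
  exact toIoo_apply v

lemma toH1_zero (v : L2R (Vec n)) : toH1 a b 0 v = primH1 n a b v := by
  have h : constH1 (n := n) a b 0 = 0 := by
    refine Subtype.ext ?_
    have : ContinuousMap.const ℝ (0 : Vec n) = 0 := rfl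
    simp only [constH1, this, map_zero]
    rfl
  rw [toH1, h, zero_add]

lemma ae_comp_sub {P : ℝ → Prop} (h : ∀ᵐ t, P t) (τ : ℝ) : ∀ᵐ t, P (t - τ) :=
  (measurePreserving_sub_right volume τ).quasiMeasurePreserving.ae h

/-- Two primitives which agree on an interval have the same derivative and the same constant. -/
lemma eq_of_add_prim_ae_eq {E : Type*} [NormedAddCommGroup E] [NormedSpace ℝ E] [CompleteSpace E]
    {a : ℝ} (ha : a < 0) {p q : E} {v u : L2R E}
    (h : ∀ᵐ t, t ∈ Ioo a 0 → q + prim v t = p + prim u t) :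
    q = p ∧ ∀ᵐ t, t ∈ Ioo a 0 → v t = u t := by
  -- Continuity upgrades a.e. equality to the closed interval, whose end point `0` gives the
  -- equality of the constants.
  have heq : EqOn (state q v) (state p u) (Icc a 0) := by
    refine Measure.eqOn_Icc_of_ae_eq volume ha.ne ?_ (state q v).continuous.continuousOn
      (state p u).continuous.continuousOn
    rw [← restrict_Ioo_eq_restrict_Icc]
    exact (ae_restrict_iff' measurableSet_Ioo).2 h
  have h0 : q = p := by simpa using heq ⟨ha.le, le_rfl⟩
  refine ⟨h0, ?_⟩
  filter_upwards [ae_hasDerivAt_prim v, ae_hasDerivAt_prim u] with t h1 h2 ht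
  refine h1.unique (h2.congr_of_eventuallyEq ?_)
  filter_upwards [isOpen_Ioo.mem_nhds ht] with s hs
  have := heq (Ioo_subset_Icc_self hs)
  simpa [h0] using this

lemma H1.ext {x y : H1 n a b} (h1 : ∀ᵐ t, t ∈ Ioo a b → x.fn t = y.fn t)
    (h2 : ∀ᵐ t, t ∈ Ioo a b → x.dt t = y.dt t) : x = y := by
  have e1 : x.fn = y.fn := Lp.ext ((ae_restrict_iff' measurableSet_Ioo).2 h1)
  have e2 : x.dt = y.dt := Lp.ext ((ae_restrict_iff' measurableSet_Ioo).2 h2)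
  exact Subtype.ext (WithLp.ofLp_injective 2 (Prod.ext e1 e2))

/-- An `H¹` function with prescribed history is determined by its derivative. -/
lemma H1.eq_toH1_of_history (ha : a < 0) (hb : 0 ≤ b) {p : Vec n} {u : L2R (Vec n)} (x : H1 n a b)
    (h : ∀ᵐ t, t ∈ Ioo a 0 → x.fn t = p + prim u t) :
    x = toH1 a b p (extend x.dt) ∧ ∀ᵐ t, t ∈ Ioo a 0 → extend x.dt t = u t := by
  obtain ⟨q, hq⟩ := x.exists_fn_eq_add_prim (ha.trans_le hb)
  obtain ⟨rfl, hv⟩ := eq_of_add_prim_ae_eq (v := extend x.dt) (q := q) (p := p) (u := u) ha (by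
    filter_upwards [hq, h] with t h1 h2 ht
    rw [← h1 ⟨ht.1, ht.2.trans_le hb⟩, h2 ht])
  refine ⟨H1.ext ?_ ?_, hv⟩
  · filter_upwards [hq, fn_toH1 (a := a) (b := b) q (extend x.dt)] with t h1 h2 ht
    rw [h1 ht, h2 ht]
  · filter_upwards [extend_apply_of_mem x.dt, dt_toH1 (a := a) (b := b) q (extend x.dt)]
      with t h1 h2 ht
    rw [← h1 ht, h2 ht]

section Solutions

variable {T τ : ℝ} {A : Matrix (Fin n) (Fin n) ℝ}

lemma isSolution_toH1_iff (hb : 0 < b) (hτ : τ ∈ Icc 0 b) {f : C(Vec n, Vec n)} {g : L2 n 0 T}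
    {φ : H1 n (-b) 0} (hT : 0 < T) {p : Vec n} {v : L2R (Vec n)} :
    IsSolution f A g φ τ (toH1 (-b) T p v) ↔
      (∀ᵐ t, t ∈ Ioo 0 T → v t = g t + (A.toEuclideanLin (p + prim v (t - τ)) - f (p + prim v t)))
      ∧ ∀ᵐ t, t ∈ Ioo (-b) 0 → p + prim v t = φ.fn t := by
  have hfn := fn_toH1 (a := -b) (b := T) p v
  have hdt := dt_toH1 (a := -b) (b := T) p v
  have hsh := ae_comp_sub hfn τ
  -- For `τ ∈ [0,b]` the delayed argument stays in `(-b,T)`, where the representatives of `x` and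
  -- `ẋ` are meaningful.
  have hmem : ∀ t ∈ Ioo 0 T, t ∈ Ioo (-b) T ∧ t - τ ∈ Ioo (-b) T := fun t ht =>
    ⟨⟨by linarith [ht.1], ht.2⟩, by linarith [ht.1, hτ.2], by linarith [ht.2, hτ.1]⟩
  refine ⟨fun h => ⟨?_, ?_⟩, fun h => ⟨?_, ?_⟩⟩
  · filter_upwards [h.eqn, hfn, hdt, hsh] with t h1 h2 h3 h4 ht
    have := h1 ht
    rw [h2 (hmem t ht).1, h3 (hmem t ht).1, h4 (hmem t ht).2] at this
    rw [eq_sub_of_add_eq this]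
    abel
  · filter_upwards [h.init, hfn] with t h1 h2 ht
    rw [← h1 ht, h2 ⟨ht.1, ht.2.trans hT⟩]
  · filter_upwards [h.1, hfn, hdt, hsh] with t h1 h2 h3 h4 ht
    rw [h2 (hmem t ht).1, h3 (hmem t ht).1, h4 (hmem t ht).2, h1 ht]
    abel
  · filter_upwards [h.2, hfn] with t h1 h2 ht
    rw [← h1 ht, h2 ⟨ht.1, ht.2.trans hT⟩]

/-- The matrix `A` as a continuous linear operator. -/
noncomputable def matrixCLM (A : Matrix (Fin n) (Fin n) ℝ) : Vec n →L[ℝ] Vec n :=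
  LinearMap.toContinuousLinearMap A.toEuclideanLin

@[simp] lemma matrixCLM_apply (A : Matrix (Fin n) (Fin n) ℝ) (x : Vec n) :
    matrixCLM A x = A.toEuclideanLin x := rfl

/-- The prescribed part of the time derivative: the derivative of the history on `(-b,0)` and the
forcing on `(0,T)`. -/
noncomputable def dataDeriv (φ : H1 n (-b) 0) (g : L2 n 0 T) : L2R (Vec n) :=
  extend φ.dt + extend g

lemma dataDeriv_apply_of_neg (φ : H1 n (-b) 0) (g : L2 n 0 T) :
    ∀ᵐ t, t < 0 → dataDeriv φ g t = extend φ.dt t := by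
  filter_upwards [Lp.coeFn_add (extend φ.dt) (extend g), extend_apply_of_notMem g] with t h1 h2 ht
  rw [dataDeriv, h1, Pi.add_apply, h2 (fun h => lt_asymm h.1 ht), add_zero]

lemma dataDeriv_apply_of_mem (φ : H1 n (-b) 0) (g : L2 n 0 T) :
    ∀ᵐ t, t ∈ Ioo 0 T → dataDeriv φ g t = g t := by
  filter_upwards [Lp.coeFn_add (extend φ.dt) (extend g), extend_apply_of_mem g,
    extend_apply_of_notMem φ.dt] with t h1 h2 h3 ht
  rw [dataDeriv, h1, Pi.add_apply, h2 ht, h3 (fun h => lt_asymm h.2 ht.1), zero_add]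

lemma dataDeriv_apply_of_notMem (hb : 0 < b) (hT : 0 < T) (φ : H1 n (-b) 0) (g : L2 n 0 T) :
    ∀ᵐ t, t ∉ Ioo (-b) T → dataDeriv φ g t = 0 := by
  filter_upwards [Lp.coeFn_add (extend φ.dt) (extend g), extend_apply_of_notMem g,
    extend_apply_of_notMem φ.dt] with t h1 h2 h3 ht
  rw [dataDeriv, h1, Pi.add_apply, h2 (fun h => ht ⟨by linarith [h.1], h.2⟩),
    h3 (fun h => ht ⟨h.1, by linarith [h.2]⟩), zero_add]

/-- The delay equation in `H¹` is equivalent to a fixed point equation for the derivative. -/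
theorem isSolution_iff (hb : 0 < b) (hT : 0 < T) (hτ : τ ∈ Icc 0 b) {f : C(Vec n, Vec n)}
    {g : L2 n 0 T} {φ : H1 n (-b) 0} {p : Vec n}
    (hp : ∀ᵐ t, t ∈ Ioo (-b) 0 → φ.fn t = p + prim (extend φ.dt) t) {x : H1 n (-b) T} :
    IsSolution f A g φ τ x ↔ ∃ v : L2R (Vec n),
      v = dataDeriv φ g + cut 0 T (delayRhs (matrixCLM A) f p τ v) ∧ x = toH1 (-b) T p v := by
  have hz : ∀ᵐ t : ℝ, t ≠ 0 := by simp [ae_iff, measure_singleton]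
  constructor
  · intro hx
    obtain ⟨h1, h2⟩ := x.eq_toH1_of_history (neg_lt_zero.2 hb) hT.le (p := p)
      (u := extend φ.dt) (by
        filter_upwards [hx.init, hp] with t h1 h2 ht
        rw [h1 ht, h2 ht])
    refine ⟨extend x.dt, eq_add_cut_iff.2 ⟨?_, ?_⟩, h1⟩
    · filter_upwards [h2, extend_apply_of_notMem x.dt, dataDeriv_apply_of_neg φ g,
        dataDeriv_apply_of_notMem hb hT φ g, hz] with t e1 e2 e3 e4 e5 ht
      -- Outside `(0,T)` the derivative is that of the history, or zero beyond `(-b,T)` by the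
      -- choice of extension; the point `t = 0` is discarded as a null set.
      by_cases hm : t ∈ Ioo (-b) T
      · have ht0 : t < 0 := by
          by_contra h0
          exact ht ⟨lt_of_le_of_ne (not_lt.1 h0) e5.symm, hm.2⟩
        rw [e1 ⟨hm.1, ht0⟩, e3 ht0]
      · rw [e2 hm, e4 hm]
    · rw [h1] at hx
      filter_upwards [((isSolution_toH1_iff hb hτ hT).1 hx).1, dataDeriv_apply_of_mem φ g]
        with t e1 e2 ht
      rw [e1 ht, e2 ht]
      rfl
  · rintro ⟨v, hv, rfl⟩
    obtain ⟨h1, h2⟩ := eq_add_cut_iff.1 hv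
    refine (isSolution_toH1_iff hb hτ hT).2 ⟨?_, ?_⟩
    · filter_upwards [h2, dataDeriv_apply_of_mem φ g] with t e1 e2 ht
      rw [e1 ht, e2 ht]
      rfl
    · have h3 : ∀ᵐ s, s ∈ Ioo (-b) 0 → v s = extend φ.dt s := by
        filter_upwards [h1, dataDeriv_apply_of_neg φ g] with s e1 e2 hs
        rw [e1 (fun h => lt_asymm h.1 hs.2), e2 hs.2]
      filter_upwards [hp] with t e1 ht
      rw [e1 ht, prim_congr h3 (by linarith) le_rfl (Ioo_subset_Icc_self ht)]

/-- The derivative `-1_(0,T) A ẋ(·-τ)` of the forcing with respect to the delay. -/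
noncomputable def sensForcing (A : Matrix (Fin n) (Fin n) ℝ) (T τ : ℝ) (v : L2R (Vec n)) :
    L2R (Vec n) :=
  -(matrixCLM A).compLpL 2 volume (trunc 0 T (translate τ v))

lemma sensForcing_apply (v : L2R (Vec n)) :
    ∀ᵐ t, (t ∈ Ioo 0 T → sensForcing A T τ v t = -A.toEuclideanLin (v (t - τ))) ∧
      (t ∉ Ioo 0 T → sensForcing A T τ v t = 0) := by
  filter_upwards [Lp.coeFn_neg ((matrixCLM A).compLpL 2 volume (trunc 0 T (translate τ v))),
    (matrixCLM A).coeFn_compLpL (p := 2) (μ := volume) (trunc 0 T (translate τ v)),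
    coeFn_trunc 0 T (translate τ v), coeFn_translate τ v] with t h1 h2 h3 h4
  rw [sensForcing, h1, Pi.neg_apply, h2, h3]
  refine ⟨fun ht => ?_, fun ht => ?_⟩
  · rw [indicator_of_mem ht, h4, matrixCLM_apply]
  · rw [indicator_of_notMem ht, map_zero, neg_zero]

lemma isSensitivity_toH1_iff (hb : 0 < b) (hT : 0 < T) (hτ : τ ∈ Icc 0 b) {f : Vec n → Vec n}
    {p : Vec n} {v w : L2R (Vec n)} :
    IsSensitivity f A τ (toH1 (-b) T p v) (toH1 (-b) T 0 w) ↔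
      (∀ᵐ t, t ∈ Ioo 0 T → w t = -A.toEuclideanLin (v (t - τ)) +
        (A.toEuclideanLin (prim w (t - τ)) - fderiv ℝ f (p + prim v t) (prim w t)))
      ∧ ∀ᵐ t, t ∈ Ioo (-b) 0 → prim w t = 0 := by
  have hfn := fn_toH1 (a := -b) (b := T) p v
  have hdts := ae_comp_sub (dt_toH1 (a := -b) (b := T) p v) τ
  have hwfn := fn_toH1 (a := -b) (b := T) 0 w
  simp only [zero_add] at hwfn
  have hwdt := dt_toH1 (a := -b) (b := T) 0 w
  have hsh := ae_comp_sub hwfn τ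
  have hmem : ∀ t ∈ Ioo 0 T, t ∈ Ioo (-b) T ∧ t - τ ∈ Ioo (-b) T := fun t ht =>
    ⟨⟨by linarith [ht.1], ht.2⟩, by linarith [ht.1, hτ.2], by linarith [ht.2, hτ.1]⟩
  refine ⟨fun h => ⟨?_, ?_⟩, fun h => ⟨?_, ?_⟩⟩
  · filter_upwards [h.eqn, hfn, hdts, hwfn, hwdt, hsh] with t h1 h2 h3 h4 h5 h6 ht
    have := h1 ht
    rw [h2 (hmem t ht).1, h3 (hmem t ht).2, h4 (hmem t ht).1, h5 (hmem t ht).1,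
      h6 (hmem t ht).2] at this
    rw [eq_sub_of_add_eq this]
    abel
  · filter_upwards [h.init, hwfn] with t h1 h2 ht
    rw [← h2 ⟨ht.1, ht.2.trans hT⟩, h1 ht]
  · filter_upwards [h.1, hfn, hdts, hwfn, hwdt, hsh] with t h1 h2 h3 h4 h5 h6 ht
    rw [h2 (hmem t ht).1, h3 (hmem t ht).2, h4 (hmem t ht).1, h5 (hmem t ht).1,
      h6 (hmem t ht).2, h1 ht]
    abel
  · filter_upwards [h.2, hwfn] with t h1 h2 ht
    rw [h2 ⟨ht.1, ht.2.trans hT⟩, h1 ht]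

/-- The sensitivity equation in `H¹` is equivalent to a fixed point equation for the derivative. -/
theorem isSensitivity_iff (hb : 0 < b) (hT : 0 < T) (hτ : τ ∈ Icc 0 b) {f : Vec n → Vec n}
    (hf : ContDiff ℝ 1 f) {p : Vec n} {v : L2R (Vec n)} {y : H1 n (-b) T} :
    IsSensitivity f A τ (toH1 (-b) T p v) y ↔ ∃ w : L2R (Vec n),
      w = sensForcing A T τ v + cut 0 T (linRhs (matrixCLM A) (fderivAlong hf (state p v)) τ w) ∧
        y = toH1 (-b) T 0 w := by
  have hz : ∀ᵐ t : ℝ, t ≠ 0 := by simp [ae_iff, measure_singleton]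
  have h00 := Lp.coeFn_zero (Vec n) 2 (volume : Measure ℝ)
  constructor
  · intro hy
    obtain ⟨h1, h2⟩ := y.eq_toH1_of_history (neg_lt_zero.2 hb) hT.le (p := 0) (u := 0) (by
        filter_upwards [hy.init] with t h1 ht
        rw [h1 ht]
        simp)
    refine ⟨extend y.dt, eq_add_cut_iff.2 ⟨?_, ?_⟩, h1⟩
    · filter_upwards [h2, extend_apply_of_notMem y.dt, sensForcing_apply (A := A) (T := T)
        (τ := τ) v, hz, h00] with t e1 e2 e3 e4 e5 ht
      rw [e3.2 ht]
      by_cases hm : t ∈ Ioo (-b) T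
      · have ht0 : t < 0 := by
          by_contra h0
          exact ht ⟨lt_of_le_of_ne (not_lt.1 h0) e4.symm, hm.2⟩
        rw [e1 ⟨hm.1, ht0⟩, e5]
        rfl
      · rw [e2 hm]
    · rw [h1] at hy
      filter_upwards [((isSensitivity_toH1_iff hb hT hτ).1 hy).1,
        sensForcing_apply (A := A) (T := T) (τ := τ) v] with t e1 e2 ht
      rw [e1 ht, e2.1 ht]
      rfl
  · rintro ⟨w, hw, rfl⟩
    obtain ⟨h1, h2⟩ := eq_add_cut_iff.1 hw
    refine (isSensitivity_toH1_iff hb hT hτ).2 ⟨?_, ?_⟩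
    · filter_upwards [h2, sensForcing_apply (A := A) (T := T) (τ := τ) v] with t e1 e2 ht
      rw [e1 ht, e2.1 ht]
      rfl
    · have h3 : ∀ᵐ s, s ∈ Ioo (-b) 0 → w s = (0 : L2R (Vec n)) s := by
        filter_upwards [h1, sensForcing_apply (A := A) (T := T) (τ := τ) v, h00] with s e1 e2 e3 hs
        have hs' : s ∉ Ioo 0 T := fun h => lt_asymm h.1 hs.2
        rw [e1 hs', e2.2 hs', e3]
        rfl
      refine Eventually.of_forall fun t ht => ?_
      rw [prim_congr h3 (by linarith) le_rfl (Ioo_subset_Icc_self ht), map_zero]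
      rfl

end Solutions

/-- The restriction `L²(a,b) → L²(c,d)` to a subinterval, as a continuous linear map. -/
noncomputable def L2.restrictCLM {a b c d : ℝ} (h : Ioo c d ⊆ Ioo a b) : L2 n a b →L[ℝ] L2 n c d :=
  LinearMap.mkContinuous
    { toFun := L2.restrict h
      map_add' := fun u v => by
        refine Lp.ext ?_
        have hac := Measure.restrict_mono h (le_refl (volume : Measure ℝ))
        filter_upwards [MemLp.coeFn_toLp ((Lp.memLp (u + v)).mono_measure hac),
          MemLp.coeFn_toLp ((Lp.memLp u).mono_measure hac),
          MemLp.coeFn_toLp ((Lp.memLp v).mono_measure hac),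
          Lp.coeFn_add (L2.restrict h u) (L2.restrict h v),
          ae_mono hac (Lp.coeFn_add u v)] with t h1 h2 h3 h4 h5
        rw [h4, Pi.add_apply]
        simp only [L2.restrict]
        rw [h1, h2, h3, h5, Pi.add_apply]
      map_smul' := fun r u => by
        refine Lp.ext ?_
        have hac := Measure.restrict_mono h (le_refl (volume : Measure ℝ))
        filter_upwards [MemLp.coeFn_toLp ((Lp.memLp (r • u)).mono_measure hac),
          MemLp.coeFn_toLp ((Lp.memLp u).mono_measure hac),
          Lp.coeFn_smul r (L2.restrict h u), ae_mono hac (Lp.coeFn_smul r u)] with t h1 h2 h3 h4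
        rw [RingHom.id_apply, h3, Pi.smul_apply]
        simp only [L2.restrict]
        rw [h1, h2, h4, Pi.smul_apply] } 1 fun u => by
    rw [one_mul]
    change ‖L2.restrict h u‖ ≤ ‖u‖
    rw [L2.restrict, Lp.norm_toLp, Lp.norm_def]
    exact ENNReal.toReal_mono (Lp.eLpNorm_ne_top u)
      (eLpNorm_mono_measure _ (Measure.restrict_mono h le_rfl))

/-- The weak derivative as a continuous linear map `H¹ → L²`. -/
noncomputable def H1.dtCLM (n : ℕ) (a b : ℝ) : H1 n a b →L[ℝ] L2 n a b :=
  ContinuousLinearMap.snd ℝ (L2 n a b) (L2 n a b) ∘L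
    (WithLp.prodContinuousLinearEquiv 2 ℝ (L2 n a b) (L2 n a b)).toContinuousLinearMap ∘L
      (H1Sub n a b).subtypeL

end DelayEq

/-! ### The main theorem. -/

open DelayEq in
theorem corollary3p3 (n : ℕ) (b T : ℝ) (hb : 0 < b) (hT : 0 < T)
    (f : DelayEq.Vec n → DelayEq.Vec n) (hf : ContDiff ℝ 1 f)
    (lam : ℝ) (hlam : 0 < lam)
    (hDf : ∀ x v : DelayEq.Vec n, 0 ≤ inner ℝ (fderiv ℝ f x v + lam • v) v)
    (A : Matrix (Fin n) (Fin n) ℝ) (g : DelayEq.L2 n 0 T) (φ : DelayEq.H1 n (-b) 0) :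
    (∀ τ ∈ Set.Icc 0 b, ∃! x : DelayEq.H1 n (-b) T, DelayEq.IsSolution f A g φ τ x) ∧
    ∀ x : ℝ → DelayEq.H1 n (-b) T,
      (∀ τ ∈ Set.Icc 0 b, DelayEq.IsSolution f A g φ τ (x τ)) →
      ContDiffOn ℝ 1 x (Set.Icc 0 b) ∧
      ∀ τ ∈ Set.Icc 0 b,
        (DelayEq.IsSensitivity f A τ (x τ) (derivWithin x (Set.Icc 0 b) τ) ∧
          ∀ w : DelayEq.H1 n (-b) T, DelayEq.IsSensitivity f A τ (x τ) w →
            w = derivWithin x (Set.Icc 0 b) τ) ∧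
        HasDerivWithinAt
          (fun σ : ℝ => DelayEq.L2.restrict
            (Set.Ioo_subset_Ioo_left (neg_nonpos.mpr hb.le)) (x σ).dt)
          (DelayEq.L2.restrict
            (Set.Ioo_subset_Ioo_left (neg_nonpos.mpr hb.le)) (derivWithin x (Set.Icc 0 b) τ).dt)
          (Set.Icc 0 b) τ := by
  -- The constant `p` is the value `φ(0)` of the continuous representative, common to all delays.
  obtain ⟨p, hp⟩ := φ.exists_fn_eq_add_prim (neg_lt_zero.2 hb)
  let fc : C(Vec n, Vec n) := ⟨f, hf.continuous⟩
  have hfc : ContDiff ℝ 1 fc := hf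
  have hex := fun τ (hτ : τ ∈ Set.Icc 0 b) => existsUnique_delay hb.le hT hτ (matrixCLM A) fc hfc
    hlam.le hDf p (dataDeriv φ g)
  have hsol := fun τ (hτ : τ ∈ Set.Icc 0 b) (x : H1 n (-b) T) =>
    isSolution_iff (A := A) (f := fc) (g := g) (x := x) hb hT hτ hp
  refine ⟨fun τ hτ => ?_, fun x hx => ?_⟩
  · obtain ⟨v, hv, huniq⟩ := hex τ hτ
    refine ⟨toH1 (-b) T p v, (hsol τ hτ _).2 ⟨v, hv, rfl⟩, fun y hy => ?_⟩
    obtain ⟨w, hw, rfl⟩ := (hsol τ hτ y).1 hy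
    rw [huniq w hw]
  -- The derivatives are chosen as a function on all of `ℝ`; the value `0` outside `[0,b]` is
  -- irrelevant.
  have hx' : ∀ τ, ∃ v : L2R (Vec n), τ ∈ Set.Icc 0 b →
      v = dataDeriv φ g + cut 0 T (delayRhs (matrixCLM A) fc p τ v) ∧ x τ = toH1 (-b) T p v := by
    intro τ
    by_cases hτ : τ ∈ Set.Icc 0 b
    · obtain ⟨v, hv⟩ := (hsol τ hτ _).1 (hx τ hτ)
      exact ⟨v, fun _ => hv⟩
    · exact ⟨0, fun h => absurd h hτ⟩
  choose v hv using hx'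
  have huD : UniqueDiffOn ℝ (Set.Icc 0 b) := uniqueDiffOn_Icc hb
  obtain ⟨hC, hder⟩ := contDiffOn_delay (matrixCLM A) fc hfc p (dataDeriv φ g) hb hT (v := v)
    (fun τ hτ w => ⟨fun hw => (hex τ hτ).unique hw (hv τ hτ).1, fun hw => hw ▸ (hv τ hτ).1⟩)
  have hxC : ContDiffOn ℝ 1 x (Set.Icc 0 b) := by
    refine ContDiffOn.congr (f := fun τ => toH1 (-b) T p (v τ)) ?_ fun τ hτ => (hv τ hτ).2
    exact contDiffOn_const.add ((primH1 n (-b) T).contDiff.comp_contDiffOn hC)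
  have hxd : ∀ τ ∈ Set.Icc 0 b, derivWithin x (Set.Icc 0 b) τ =
      toH1 (-b) T 0 (derivWithin v (Set.Icc 0 b) τ) := by
    intro τ hτ
    have h1 := ((hC.differentiableOn one_ne_zero) τ hτ).hasDerivWithinAt
    have h2 : HasDerivWithinAt (fun τ => toH1 (-b) T p (v τ))
        (primH1 n (-b) T (derivWithin v (Set.Icc 0 b) τ)) (Set.Icc 0 b) τ :=
      ((primH1 n (-b) T).hasFDerivAt.comp_hasDerivWithinAt τ h1).const_add (constH1 (-b) T p)
    rw [toH1_zero]
    exact (h2.congr (fun σ hσ => (hv σ hσ).2) (hv τ hτ).2).derivWithin (huD τ hτ)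
  refine ⟨hxC, fun τ hτ => ⟨⟨?_, fun w hw => ?_⟩, ?_⟩⟩
  · rw [(hv τ hτ).2, hxd τ hτ]
    exact (isSensitivity_iff hb hT hτ hf).2 ⟨_, hder τ hτ, rfl⟩
  · rw [(hv τ hτ).2] at hw
    obtain ⟨ω, hω, rfl⟩ := (isSensitivity_iff hb hT hτ hf).1 hw
    rw [hxd τ hτ, (existsUnique_linRhs (matrixCLM A) (fderivAlong hf (state p (v τ))) hb.le hT hτ
      (sensForcing A T τ (v τ))).unique hω (hder τ hτ)]
  -- Taking the weak time derivative and restricting it to `(0,T)` is continuous and linear on `H¹`,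
  -- so it commutes with differentiation in the delay.
  · exact (L2.restrictCLM (Set.Ioo_subset_Ioo_left (neg_nonpos.mpr hb.le)) ∘L H1.dtCLM n (-b) T).hasFDerivAt.comp_hasDerivWithinAt τ
      ((hxC.differentiableOn one_ne_zero) τ hτ).hasDerivWithinAt
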